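/- Let $n=2^{J_n}\ge 8$ and $0=x_1<x_2<\dots<x_n<x_{n+1}=1$. One observes $Y_i=\mu_i+\sigma\varepsilon_i$, $i=1,\dots,n$, where $\sigma>0$, the $\varepsilon_i$ are i.i.d. standard Gaussian random variables, and $\mu_i=f(x_i)$ for a function $f:[0,1]\to\mathbb R$. Write $\langle x,y\rangle_n=\frac1n\sum_{i=1}^n x_iy_i$, and $\|\cdot\|_n$ for the associated norm, $\|\cdot\|$ for the Euclidean norm. Set $\Lambda(0)=\{(0,0)\}$, $\Lambda(j)=\{j\}\times\{0,\dots,2^{j-1}-1\}$ for $j\ge1$, and $\Lambda^*=\bigcup_{j=0}^{J_n-1}\Lambda(j)$, so that $|\Lambda^*|=n/2$. Let $v_{0,0}=(1,\dots,1)'$ and, for $j\ge 1$, $[v_{j,k}]_i=2^{(j-1)/2}\big(\mathbf 1_{I^+_{j,k}}(i)-\mathbf 1_{I^-_{j,k}}(i)\big)$ with $I^+_{j,k}=\{1+(2k+1)2^{-j}n,\dots,(2k+2)2^{-j}n\}$ and $I^-_{j,k}=\{1+2k\,2^{-j}n,\dots,(2k+1)2^{-j}n\}$. For $m\subset\Lambda^*$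 let $\mathcal S_m=\mathrm{span}\{v_{j,k}:(j,k)\in m\}$, let $\hat\mu_m$ be the orthogonal projection of $Y$ onto $\mathcal S_m$, let $\hat\sigma^2=\|Y-\hat\mu_{\Lambda^*}\|^2/(n-\dim\mathcal S_{\Lambda^*})$, and, for $\beta>0$, let $$\hat\mu=\sum_{m\subset\Lambda^*}w_m\hat\mu_m,\qquad w_m=\frac{\pi_m}{\mathcal Z}\exp\Big(\beta\frac{\|\hat\mu_m\|^2}{\hat\sigma^2}-b|m|\Big),\qquad \pi_m=\Big(1+\frac1{p^{\alpha}}\Big)^{-p}p^{-\alpha|m|},$$ with $p=n/2$, $\alpha=b=1$, and $\mathcal Z$ normalizing the sum of the $w_m$ to one. Let $\phi^{-1}:\,]0,\infty[\,\to\,]0,1[$ be the inverse of $\phi(x)=(x-1-\log x)/2$, and assume that $$0<\beta\le\tfrac12\,\phi^{-1}\Big(\frac{2\log(n/2)}n\Big).$$ Then $\hat\mu$ is the shrinkage estimator $$\hat\mu=\sum_{(j,k)\in\Lambda^*}\frac{Z_{j,k}\exp(n\beta Z_{j,k}^2/\hat\sigma^2)}{en/2+\exp(n\beta Z_{j,k}^2/\hat\sigma^2)}\,v_{j,k},\qquad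 Z_{j,k}=\langle Y,v_{j,k}\rangle_n,\qquad \hat\sigma^2=2\Big(\langle Y,Y\rangle_n-\sum_{(j,k)\in\Lambda^*}Z_{j,k}^2\Big),$$ and there exists a numerical constant $C$ (independent of $n$, $\beta$, $x_1,\dots,x_n$, $\sigma$ and $f$) such that, for any function $f$ with finite total variation $V(f)$ on $[0,1]$, $$\mathbb E\,\|\mu-\hat\mu\|_n^2\ \le\ \frac C\beta\,\max\Big\{\Big(\frac{V(f)\sigma^2\log n}{n}\Big)^{2/3},\ \frac{V(f)^2}{n},\ \frac{\sigma^2\log n}{n}\Big\}.$$ -/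

import Mathlib

open MeasureTheory ProbabilityTheory

noncomputable section

namespace HaarMix

/-- The function `φ(x) = (x - 1 - log x) / 2`, considered on `]0,1[`. -/
def phi (x : ℝ) : ℝ := (x - 1 - Real.log x) / 2

/-- `φ` is a bijection from `]0,1[` onto `]0,∞[`, so that its inverse is well defined there. -/
theorem phi_bijOn : Set.BijOn phi (Set.Ioo 0 1) (Set.Ioi 0) := by
  refine ⟨?_, ?_, ?_⟩
  · rintro x ⟨h0, h1⟩
    have := Real.log_lt_sub_one_of_pos h0 h1.ne
    simp only [phi, Set.mem_Ioi]
    linarith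
  · have key : ∀ x ∈ Set.Ioo (0 : ℝ) 1, ∀ y ∈ Set.Ioo (0 : ℝ) 1, x < y → phi x ≠ phi y := by
      rintro x ⟨hx0, hx1⟩ y ⟨hy0, hy1⟩ hxy h
      have hne : x / y ≠ 1 := by
        rw [ne_eq, div_eq_one_iff_eq hy0.ne']
        exact hxy.ne
      have h1 := Real.log_lt_sub_one_of_pos (div_pos hx0 hy0) hne
      rw [Real.log_div hx0.ne' hy0.ne'] at h1
      have h2 : x / y - 1 ≤ x - y := by
        rw [div_sub_one hy0.ne', div_le_iff₀ hy0]
        nlinarith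
      simp only [phi] at h
      linarith
    intro x hx y hy h
    rcases lt_trichotomy x y with hlt | heq | hgt
    · exact absurd h (key x hx y hy hlt)
    · exact heq
    · exact absurd h.symm (key y hy x hx hgt)
  · intro y hy
    have hy' : 0 < y := hy
    have ha : (0 : ℝ) < Real.exp (-(2 * y + 1)) := Real.exp_pos _
    have ha1 : Real.exp (-(2 * y + 1)) ≤ 1 := Real.exp_le_one_iff.2 (by linarith)
    have hc : ContinuousOn phi (Set.Icc (Real.exp (-(2 * y + 1))) 1) := by
      unfold phi
      refine ContinuousOn.div_const (ContinuousOn.sub (by fun_prop) ?_) _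
      exact Real.continuousOn_log.mono fun x hx => (ha.trans_le hx.1).ne'
    have hmem : y ∈ Set.Icc (phi 1) (phi (Real.exp (-(2 * y + 1)))) := by
      simp only [phi, Real.log_one, Real.log_exp, Set.mem_Icc]
      constructor <;> linarith
    obtain ⟨x, hx, hxy⟩ := intermediate_value_Icc' ha1 hc hmem
    refine ⟨x, ⟨ha.trans_le hx.1, lt_of_le_of_ne hx.2 ?_⟩, hxy⟩
    rintro rfl
    simp [phi] at hxy
    exact hy'.ne hxy

/-- The inverse `φ⁻¹ : ]0,∞[ → ]0,1[` of `φ` (used at positive arguments only). -/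
def phiInv (y : ℝ) : ℝ := Function.invFunOn phi (Set.Ioo 0 1) y

/-! ### The mixing procedure on all the subsets of a finite family of vectors -/

section Mixing

variable {n : ℕ} {ι : Type*}

/-- The model `S_m = span {v_j : j ∈ m}`. -/
def model (v : ι → EuclideanSpace ℝ (Fin n)) (m : Finset ι) :
    Submodule ℝ (EuclideanSpace ℝ (Fin n)) :=
  Submodule.span ℝ (v '' (m : Set ι))

/-- The least-squares estimator `Π_{S_m} y` on the model `S_m`. -/
def leastSquares (v : ι → EuclideanSpace ℝ (Fin n)) (m : Finset ι)
    (y : EuclideanSpace ℝ (Fin n)) : EuclideanSpace ℝ (Fin n) :=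
  (model v m).starProjection y

/-- The residual variance estimator `‖y - Π_{S_*} y‖² / (n - dim S_*)`, where `S_*` is the largest
model `S_Λ`. -/
def residualVariance (v : ι → EuclideanSpace ℝ (Fin n)) (Λ : Finset ι)
    (y : EuclideanSpace ℝ (Fin n)) : ℝ :=
  ‖y - leastSquares v Λ y‖ ^ 2 / ((n : ℝ) - (Module.finrank ℝ (model v Λ) : ℝ))

/-- The prior `π_m = (1 + p^{-α})^{-p} p^{-α |m|}` on the subsets of a set with `p` elements. -/
def prior (p : ℕ) (α : ℝ) (m : Finset ι) : ℝ :=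
  ((1 + 1 / (p : ℝ) ^ α) ^ p)⁻¹ * (p : ℝ) ^ (-α * (m.card : ℝ))

/-- The unnormalized weight `π_m exp (β ‖Π_{S_m} y‖² / σ̂² - L_m)` with `L_m = b |m|`. -/
def rawWeight (v : ι → EuclideanSpace ℝ (Fin n)) (Λ : Finset ι) (α b β : ℝ)
    (y : EuclideanSpace ℝ (Fin n)) (m : Finset ι) : ℝ :=
  prior Λ.card α m *
    Real.exp (β * (‖leastSquares v m y‖ ^ 2 / residualVariance v Λ y) - b * (m.card : ℝ))

/-- The mixing estimator `∑_m w_m Π_{S_m} y`, where `m` runs over all the subsets of `Λ` and the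
`w_m` are the weights `rawWeight`, normalized to have sum one. -/
def mixingEstimator (v : ι → EuclideanSpace ℝ (Fin n)) (Λ : Finset ι) (α b β : ℝ)
    (y : EuclideanSpace ℝ (Fin n)) : EuclideanSpace ℝ (Fin n) :=
  ∑ m ∈ Λ.powerset,
    (rawWeight v Λ α b β y m / ∑ m' ∈ Λ.powerset, rawWeight v Λ α b β y m') •
      leastSquares v m y

/-- The scalar product `⟨u, w⟩_n = (1/n) ∑ u_i w_i`. -/
def empInner (u w : EuclideanSpace ℝ (Fin n)) : ℝ := (1 / (n : ℝ)) * ∑ i, u i * w i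

end Mixing

/-! ### The Haar family for `n = 2 ^ J` -/

/-- `Λ(0) = {(0,0)}` and `Λ(j) = {j} × {0, …, 2^{j-1} - 1}` for `j ≥ 1`. -/
def haarLevel (j : ℕ) : Finset (ℕ × ℕ) :=
  if j = 0 then {(0, 0)} else {j} ×ˢ Finset.range (2 ^ (j - 1))

/-- `Λ^* = ⋃_{0 ≤ j ≤ J - 1} Λ(j)`. -/
def haarIndex (J : ℕ) : Finset (ℕ × ℕ) := (Finset.range J).biUnion haarLevel

/-- `I⁺_{j,k} = {1 + (2k+1) 2^{-j} n, …, (2k+2) 2^{-j} n}`, for `n = 2 ^ J` and `j ≤ J`. -/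
def haarPos (J j k : ℕ) : Finset ℕ :=
  Finset.Icc (1 + (2 * k + 1) * 2 ^ (J - j)) ((2 * k + 2) * 2 ^ (J - j))

/-- `I⁻_{j,k} = {1 + 2k 2^{-j} n, …, (2k+1) 2^{-j} n}`, for `n = 2 ^ J` and `j ≤ J`. -/
def haarNeg (J j k : ℕ) : Finset ℕ :=
  Finset.Icc (1 + 2 * k * 2 ^ (J - j)) ((2 * k + 1) * 2 ^ (J - j))

/-- The Haar vectors: `v_{0,0}` is the constant vector `1`, and
`[v_{j,k}]_i = 2^{(j-1)/2} (1_{I⁺_{j,k}}(i) - 1_{I⁻_{j,k}}(i))` for `j ≥ 1`. The coordinates are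
numbered from `1` in the formula and from `0` in `Fin (2 ^ J)`. -/
def haarVec (J : ℕ) (jk : ℕ × ℕ) : EuclideanSpace ℝ (Fin (2 ^ J)) :=
  WithLp.toLp 2 fun i =>
    if jk.1 = 0 then 1
    else (2 : ℝ) ^ (((jk.1 : ℝ) - 1) / 2) *
      ((if (i : ℕ) + 1 ∈ haarPos J jk.1 jk.2 then 1 else 0) -
        (if (i : ℕ) + 1 ∈ haarNeg J jk.1 jk.2 then 1 else 0))

/-- The estimator `μ̂`: mixing over the models spanned by the subfamilies of
`{v_{j,k} : (j,k) ∈ Λ^*}`, with `α = b = 1`. -/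
def haarEstimator (J : ℕ) (β : ℝ) (y : EuclideanSpace ℝ (Fin (2 ^ J))) :
    EuclideanSpace ℝ (Fin (2 ^ J)) :=
  mixingEstimator (haarVec J) (haarIndex J) 1 1 β y

/-- `σ̂² = 2 (⟨y, y⟩_n - ∑ Z_{j,k}²)` with `Z_{j,k} = ⟨y, v_{j,k}⟩_n`. -/
def haarVariance (J : ℕ) (y : EuclideanSpace ℝ (Fin (2 ^ J))) : ℝ :=
  2 * (empInner y y - ∑ jk ∈ haarIndex J, empInner y (haarVec J jk) ^ 2)

/-- The shrinkage estimator
`∑ (Z_{j,k} exp (n β Z_{j,k}² / σ̂²) / (e n / 2 + exp (n β Z_{j,k}² / σ̂²))) v_{j,k}`. -/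
def haarShrinkage (J : ℕ) (β : ℝ) (y : EuclideanSpace ℝ (Fin (2 ^ J))) :
    EuclideanSpace ℝ (Fin (2 ^ J)) :=
  ∑ jk ∈ haarIndex J,
    (empInner y (haarVec J jk) *
        Real.exp (2 ^ J * β * empInner y (haarVec J jk) ^ 2 / haarVariance J y) /
      (Real.exp 1 * 2 ^ J / 2 +
        Real.exp (2 ^ J * β * empInner y (haarVec J jk) ^ 2 / haarVariance J y))) •
      haarVec J jk

/-- The vector `μ = (f(x_1), …, f(x_n))` for the design `0 = x_1 < ⋯ < x_n < x_{n+1} = 1`. -/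
def signal {n : ℕ} (f : ℝ → ℝ) (x : Fin (n + 1) → ℝ) : EuclideanSpace ℝ (Fin n) :=
  WithLp.toLp 2 fun i => f (x i.castSucc)

/-- The observations `Y_i = μ_i + σ ε_i`. -/
def observation {n : ℕ} {Ω : Type*} (μ : EuclideanSpace ℝ (Fin n)) (σ : ℝ)
    (ε : Fin n → Ω → ℝ) (ω : Ω) : EuclideanSpace ℝ (Fin n) :=
  WithLp.toLp 2 fun i => μ i + σ * ε i ω

/-- The squared loss `‖μ - μ̂‖²_n` of the estimator `μ̂` computed from the observations `y`. -/
def haarLoss (J : ℕ) (β : ℝ) (μ y : EuclideanSpace ℝ (Fin (2 ^ J))) : ℝ :=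
  empInner (μ - haarEstimator J β y) (μ - haarEstimator J β y)

/-- The total variation `V(f)` of `f` on `[0,1]`. -/
def totalVariation (f : ℝ → ℝ) : ℝ := (eVariationOn f (Set.Icc 0 1)).toReal

end HaarMix

end

/-!
The prior is a product measure on the subsets of `Λ^*` and the Haar vectors are orthonormal for
`⟨·,·⟩_n`, so the mixture factorises over the coordinates and shrinks each empirical coefficient
`Z_{j,k}` separately, by the factor `e^t / (e n / 2 + e^t)` at `t = n β Z_{j,k}² / σ̂²`. This factor
is a smooth threshold, at the level `Z² ≈ σ̂² log n / (n β)`.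

The `Z_{j,k}` are independent Gaussian variables of variance `σ² / n`, and `σ̂²` only involves those
of the finest level, which `μ̂` does not use. Chernoff's bound, whose rate function is `φ`, shows
that under the condition on `β` one has `σ̂² > 2 β σ²` outside an event of probability `2 / n`; then
`t ≤ n Z² / (2 σ²)`, so that the threshold is not below the universal one and pure noise leaks only
`O(σ² log n / n²)` per coordinate. Hence the risk of a coordinate is, up to that term and a
constant, the minimum of its squared signal `⟨μ, v_{j,k}⟩_n²` and of
`D = (σ² + 2 V² / n) log n / (n β)`, where `2 V² / n` bounds the bias of `σ̂²`.

Finally, a signal of variation `V` has Haar coefficients whose absolute values sum to at most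
`V 2^{-j/2}` at the level `j`. As there are at most `2^j` coefficients at that level, its minima add
up to at most `min(2^j D, V √D 2^{-j/2})`, and summing over `j` gives the rate `(V D)^{2/3}`.
-/

noncomputable section

namespace HaarMix

section Shrink

/-- The shrinkage factor `e ^ t / (A + e ^ t)`, which multiplies an empirical coefficient with
signal-to-noise ratio `t`; it is negligible for `t` well below `log A` and close to `1` well
above. -/
def shrink (A t : ℝ) : ℝ := Real.exp t / (A + Real.exp t)

variable {A : ℝ}

theorem shrink_nonneg (hA : 0 ≤ A) (t : ℝ) : 0 ≤ shrink A t := by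
  unfold shrink
  positivity

theorem shrink_le_one (hA : 0 ≤ A) (t : ℝ) : shrink A t ≤ 1 :=
  div_le_one_of_le₀ (le_add_of_nonneg_left hA) (by positivity)

theorem one_sub_shrink (hA : 0 ≤ A) (t : ℝ) : 1 - shrink A t = A / (A + Real.exp t) := by
  rw [shrink, one_sub_div (by positivity), add_sub_cancel_right]

theorem shrink_mono (hA : 0 ≤ A) : Monotone (shrink A) := by
  intro s t hst
  rw [← sub_le_sub_iff_left 1, one_sub_shrink hA, one_sub_shrink hA]
  gcongr

theorem measurable_shrink (A : ℝ) : Measurable (shrink A) := by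
  unfold shrink
  fun_prop

theorem odds_div_one_add_odds (hA : 0 < A) (t : ℝ) :
    Real.exp t / A / (1 + Real.exp t / A) = shrink A t := by
  unfold shrink
  field_simp

theorem mul_one_sub_shrink_le (hA : 1 ≤ A) (t : ℝ) : t * (1 - shrink A t) ≤ Real.log A + 1 := by
  have hA0 : 0 < A := by linarith
  have hlog : 0 ≤ Real.log A := Real.log_nonneg hA
  rw [one_sub_shrink hA0.le, ← mul_div_assoc, div_le_iff₀ (by positivity)]
  have hexp : A * (t - Real.log A) ≤ Real.exp t := by
    have h := Real.add_one_le_exp (t - Real.log A)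
    rw [Real.exp_sub, Real.exp_log hA0, le_div_iff₀ hA0] at h
    linarith
  nlinarith [mul_nonneg hlog hA0.le, mul_nonneg hlog (Real.exp_pos t).le]

end Shrink

section Mixing

variable {n : ℕ} {ι : Type*}

theorem inner_eq_mul_empInner (u w : EuclideanSpace ℝ (Fin n)) :
    inner ℝ u w = n * empInner u w := by
  rcases n.eq_zero_or_pos with rfl | hn
  · simp [PiLp.inner_apply]
  · simp [empInner, PiLp.inner_apply, mul_comm, hn.ne']

theorem empInner_eq_inner_div (u w : EuclideanSpace ℝ (Fin n)) :
    empInner u w = inner ℝ u w / n := by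
  simp [empInner, PiLp.inner_apply, mul_comm, div_eq_mul_inv]

theorem norm_sq_eq_mul_empInner (u : EuclideanSpace ℝ (Fin n)) : ‖u‖ ^ 2 = n * empInner u u := by
  rw [← real_inner_self_eq_norm_sq, inner_eq_mul_empInner]

theorem empInner_comm (u w : EuclideanSpace ℝ (Fin n)) : empInner u w = empInner w u := by
  rw [empInner_eq_inner_div, empInner_eq_inner_div, real_inner_comm]

theorem empInner_sub_left (u u' w : EuclideanSpace ℝ (Fin n)) :
    empInner (u - u') w = empInner u w - empInner u' w := by
  simp only [empInner_eq_inner_div, inner_sub_left, sub_div]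

theorem empInner_smul_left (c : ℝ) (u w : EuclideanSpace ℝ (Fin n)) :
    empInner (c • u) w = c * empInner u w := by
  simp only [empInner_eq_inner_div, real_inner_smul_left, mul_div_assoc]

theorem empInner_sum_left (s : Finset ι) (u : ι → EuclideanSpace ℝ (Fin n))
    (w : EuclideanSpace ℝ (Fin n)) : empInner (∑ a ∈ s, u a) w = ∑ a ∈ s, empInner (u a) w := by
  simp only [empInner_eq_inner_div, sum_inner, Finset.sum_div]

/-- The vectors `v a`, `a ∈ Λ`, are orthonormal for the empirical scalar product `⟨·,·⟩_n`. -/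
def EmpOrthonormal (v : ι → EuclideanSpace ℝ (Fin n)) (Λ : Finset ι) : Prop :=
  (∀ a ∈ Λ, empInner (v a) (v a) = 1) ∧ ∀ a ∈ Λ, ∀ b ∈ Λ, a ≠ b → empInner (v a) (v b) = 0

namespace EmpOrthonormal

variable {v : ι → EuclideanSpace ℝ (Fin n)} {Λ m : Finset ι}

theorem mono (h : EmpOrthonormal v Λ) (hm : m ⊆ Λ) : EmpOrthonormal v m :=
  ⟨fun a ha => h.1 a (hm ha), fun a ha b hb => h.2 a (hm ha) b (hm hb)⟩

theorem empInner_sum (h : EmpOrthonormal v Λ) (c : ι → ℝ) {b : ι} (hb : b ∈ Λ) :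
    empInner (∑ a ∈ Λ, c a • v a) (v b) = c b := by
  rw [empInner_sum_left, Finset.sum_eq_single_of_mem b hb, empInner_smul_left, h.1 b hb, mul_one]
  intro a ha hab
  rw [empInner_smul_left, h.2 a ha b hb hab, mul_zero]

theorem empInner_sum_self (h : EmpOrthonormal v Λ) (c : ι → ℝ) :
    empInner (∑ a ∈ Λ, c a • v a) (∑ a ∈ Λ, c a • v a) = ∑ a ∈ Λ, c a ^ 2 := by
  rw [empInner_sum_left]
  refine Finset.sum_congr rfl fun a ha => ?_
  rw [empInner_smul_left, empInner_comm, h.empInner_sum c ha, sq]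

theorem leastSquares_eq (h : EmpOrthonormal v m) (y : EuclideanSpace ℝ (Fin n)) :
    leastSquares v m y = ∑ a ∈ m, empInner y (v a) • v a := by
  refine Submodule.eq_starProjection_of_mem_of_inner_eq_zero ?_ fun w hw => ?_
  · exact Submodule.sum_mem _ fun a ha =>
      Submodule.smul_mem _ _ (Submodule.subset_span ⟨a, ha, rfl⟩)
  · induction hw using Submodule.span_induction with
    | mem x hx =>
      obtain ⟨a, ha, rfl⟩ := hx
      rw [inner_eq_mul_empInner, empInner_sub_left, h.empInner_sum _ ha, sub_self, mul_zero]
    | zero => exact inner_zero_right _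
    | add x y _ _ hx hy => rw [inner_add_right, hx, hy, add_zero]
    | smul c x _ hx => rw [real_inner_smul_right, hx, mul_zero]

theorem norm_sq_leastSquares (h : EmpOrthonormal v m) (y : EuclideanSpace ℝ (Fin n)) :
    ‖leastSquares v m y‖ ^ 2 = n * ∑ a ∈ m, empInner y (v a) ^ 2 := by
  rw [norm_sq_eq_mul_empInner, h.leastSquares_eq, h.empInner_sum_self]

theorem linearIndependent (h : EmpOrthonormal v m) : LinearIndependent ℝ fun a : m => v a := by
  refine linearIndependent_of_ne_zero_of_inner_eq_zero (fun a h0 => ?_) fun a b hab => ?_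
  · have h1 := h.1 a a.2
    rw [h0, empInner_eq_inner_div, inner_zero_left, zero_div] at h1
    exact zero_ne_one h1
  · simp only [inner_eq_mul_empInner, h.2 a a.2 b b.2 (Subtype.coe_injective.ne hab), mul_zero]

theorem finrank_model (h : EmpOrthonormal v m) : Module.finrank ℝ (model v m) = m.card := by
  rw [model, Set.image_eq_range]
  exact (finrank_span_eq_card h.linearIndependent).trans (Fintype.card_coe m)

theorem eq_sum (h : EmpOrthonormal v Λ) (hcard : Λ.card = n) (y : EuclideanSpace ℝ (Fin n)) :
    y = ∑ a ∈ Λ, empInner y (v a) • v a := by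
  have htop : model v Λ = ⊤ :=
    Submodule.eq_top_of_finrank_eq (by rw [h.finrank_model, hcard, finrank_euclideanSpace_fin])
  rw [← h.leastSquares_eq, leastSquares]
  exact (Submodule.starProjection_eq_self_iff.2 (htop ▸ Submodule.mem_top)).symm

theorem parseval (h : EmpOrthonormal v Λ) (hcard : Λ.card = n) (y : EuclideanSpace ℝ (Fin n)) :
    empInner y y = ∑ a ∈ Λ, empInner y (v a) ^ 2 := by
  conv_lhs => rw [h.eq_sum hcard y]
  exact h.empInner_sum_self _

theorem residualVariance_eq (h : EmpOrthonormal v m) (y : EuclideanSpace ℝ (Fin n)) :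
    residualVariance v m y =
      n * (empInner y y - ∑ a ∈ m, empInner y (v a) ^ 2) / (n - m.card) := by
  have hpyth : ‖y - leastSquares v m y‖ ^ 2 = ‖y‖ ^ 2 - ‖leastSquares v m y‖ ^ 2 := by
    rw [eq_sub_iff_add_eq', Submodule.norm_sq_eq_add_norm_sq_starProjection y (model v m),
      Submodule.starProjection_orthogonal_val]
    rfl
  rw [residualVariance, h.finrank_model, hpyth, h.norm_sq_leastSquares, norm_sq_eq_mul_empInner,
    mul_sub]

theorem rawWeight_eq (h : EmpOrthonormal v Λ) (hm : m ⊆ Λ) (α b β : ℝ)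
    (y : EuclideanSpace ℝ (Fin n)) :
    rawWeight v Λ α b β y m = ((1 + 1 / (Λ.card : ℝ) ^ α) ^ Λ.card)⁻¹ *
      ∏ a ∈ m, Real.exp (n * β * empInner y (v a) ^ 2 / residualVariance v Λ y) /
        (Real.exp b * (Λ.card : ℝ) ^ α) := by
  have hfit : β * (‖leastSquares v m y‖ ^ 2 / residualVariance v Λ y) =
      ∑ a ∈ m, n * β * empInner y (v a) ^ 2 / residualVariance v Λ y := by
    rw [(h.mono hm).norm_sq_leastSquares, ← Finset.sum_div, ← Finset.mul_sum]
    ring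
  have hprior : (Λ.card : ℝ) ^ (-α * (m.card : ℝ)) = ((Λ.card : ℝ) ^ α)⁻¹ ^ m.card := by
    rw [Real.rpow_mul_natCast (Nat.cast_nonneg _), Real.rpow_neg (Nat.cast_nonneg _)]
  have hpenalty : Real.exp (b * m.card) = Real.exp b ^ m.card := by
    rw [mul_comm, Real.exp_nat_mul]
  rw [rawWeight, prior, mul_assoc, hfit, hprior, Real.exp_sub, hpenalty, Real.exp_sum,
    Finset.prod_div_distrib, Finset.prod_const, mul_pow, inv_pow]
  ring

end EmpOrthonormal

theorem sum_powerset_prod_smul_sum {K E : Type*} [Field K] [AddCommGroup E] [Module K E]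
    (Λ : Finset ι) (q : ι → K) (hq : ∀ a ∈ Λ, 1 + q a ≠ 0) (u : ι → E) :
    ∑ m ∈ Λ.powerset, (∏ a ∈ m, q a) • ∑ a ∈ m, u a =
      (∏ a ∈ Λ, (1 + q a)) • ∑ a ∈ Λ, (q a / (1 + q a)) • u a := by
  classical
  induction Λ using Finset.induction_on with
  | empty => simp
  | insert b s hb ih =>
    have hqb : 1 + q b ≠ 0 := hq b (Finset.mem_insert_self _ _)
    have hwith : ∀ t ∈ s.powerset, (∏ a ∈ insert b t, q a) • ∑ a ∈ insert b t, u a =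
        (q b * ∏ a ∈ t, q a) • u b + q b • ((∏ a ∈ t, q a) • ∑ a ∈ t, u a) := by
      intro t ht
      have hbt : b ∉ t := fun h => hb (Finset.mem_powerset.1 ht h)
      rw [Finset.prod_insert hbt, Finset.sum_insert hbt, smul_add, smul_smul]
    have hcancel : (1 + q b) * (∏ a ∈ s, (1 + q a)) * (q b / (1 + q b)) =
        q b * ∏ a ∈ s, (1 + q a) := by field_simp
    rw [Finset.sum_powerset_insert hb, Finset.sum_congr rfl hwith, Finset.sum_add_distrib,
      ← Finset.smul_sum, ih fun a ha => hq a (Finset.mem_insert_of_mem ha), ← Finset.sum_smul,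
      ← Finset.mul_sum, ← Finset.prod_one_add, Finset.sum_insert hb, Finset.prod_insert hb,
      smul_add, smul_smul _ _ (u b), hcancel]
    module

theorem EmpOrthonormal.mixingEstimator_eq {v : ι → EuclideanSpace ℝ (Fin n)} {Λ : Finset ι}
    (h : EmpOrthonormal v Λ) (α b β : ℝ) (y : EuclideanSpace ℝ (Fin n)) :
    mixingEstimator v Λ α b β y = ∑ a ∈ Λ,
      (shrink (Real.exp b * (Λ.card : ℝ) ^ α)
        (n * β * empInner y (v a) ^ 2 / residualVariance v Λ y) * empInner y (v a)) • v a := by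
  set A : ℝ := Real.exp b * (Λ.card : ℝ) ^ α
  set q : ι → ℝ := fun a => Real.exp (n * β * empInner y (v a) ^ 2 / residualVariance v Λ y) / A
  have hq : ∀ a, 0 < 1 + q a := fun a => by positivity
  have hP : 0 < ∏ a ∈ Λ, (1 + q a) := Finset.prod_pos fun a _ => hq a
  have hsum : ∑ m ∈ Λ.powerset, rawWeight v Λ α b β y m =
      ((1 + 1 / (Λ.card : ℝ) ^ α) ^ Λ.card)⁻¹ * ∏ a ∈ Λ, (1 + q a) := by
    rw [Finset.prod_one_add, Finset.mul_sum]
    exact Finset.sum_congr rfl fun m hm => h.rawWeight_eq (Finset.mem_powerset.1 hm) α b β y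
  have hterm : ∀ m ∈ Λ.powerset,
      (rawWeight v Λ α b β y m / ∑ m' ∈ Λ.powerset, rawWeight v Λ α b β y m') •
        leastSquares v m y =
      (∏ a ∈ Λ, (1 + q a))⁻¹ • ((∏ a ∈ m, q a) • ∑ a ∈ m, empInner y (v a) • v a) := by
    intro m hm
    have hm := Finset.mem_powerset.1 hm
    rw [hsum, h.rawWeight_eq hm, (h.mono hm).leastSquares_eq, smul_smul,
      mul_div_mul_left _ _ (by positivity), div_eq_inv_mul]
  rw [mixingEstimator, Finset.sum_congr rfl hterm, ← Finset.smul_sum,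
    sum_powerset_prod_smul_sum Λ q fun a _ => (hq a).ne', inv_smul_smul₀ hP.ne']
  refine Finset.sum_congr rfl fun a ha => ?_
  have hA : 0 < A := by
    have := Finset.card_pos.2 ⟨a, ha⟩
    positivity
  rw [smul_smul, odds_div_one_add_odds hA]

end Mixing

section Haar

theorem mem_haarIndex {J j k : ℕ} :
    (j, k) ∈ haarIndex J ↔ j < J ∧ (if j = 0 then k = 0 else k < 2 ^ (j - 1)) := by
  simp only [haarIndex, Finset.mem_biUnion, Finset.mem_range, haarLevel]
  constructor
  · rintro ⟨i, hi, hmem⟩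
    split_ifs at hmem with hi0 <;> aesop
  · rintro ⟨hj, hk⟩
    refine ⟨j, hj, ?_⟩
    split_ifs at hk ⊢ with hj0 <;> aesop

theorem haarIndex_succ (J : ℕ) : haarIndex (J + 1) = haarLevel J ∪ haarIndex J := by
  rw [haarIndex, Finset.range_add_one, Finset.biUnion_insert, haarIndex]

theorem haarIndex_subset_succ (J : ℕ) : haarIndex J ⊆ haarIndex (J + 1) :=
  haarIndex_succ J ▸ Finset.subset_union_right

theorem haarLevel_subset_succ (J : ℕ) : haarLevel J ⊆ haarIndex (J + 1) :=
  haarIndex_succ J ▸ Finset.subset_union_left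

theorem fst_eq_of_mem_haarLevel {j : ℕ} {a : ℕ × ℕ} (ha : a ∈ haarLevel j) : a.1 = j := by
  rw [haarLevel] at ha
  split_ifs at ha <;> aesop

theorem disjoint_haarLevel {i j : ℕ} (hij : i ≠ j) : Disjoint (haarLevel i) (haarLevel j) :=
  Finset.disjoint_left.2 fun _ hi hj =>
    hij ((fst_eq_of_mem_haarLevel hi).symm.trans (fst_eq_of_mem_haarLevel hj))

theorem disjoint_haarLevel_haarIndex (J : ℕ) : Disjoint (haarLevel J) (haarIndex J) :=
  (Finset.disjoint_biUnion_right _ _ _).2 fun _ hj =>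
    disjoint_haarLevel (Finset.mem_range.1 hj).ne'

theorem card_haarLevel_succ (J : ℕ) : (haarLevel (J + 1)).card = 2 ^ J := by
  simp [haarLevel]

theorem card_haarIndex_succ (J : ℕ) : (haarIndex (J + 1)).card = 2 ^ J := by
  induction J with
  | zero => simp [haarIndex, haarLevel]
  | succ J ih =>
    rw [haarIndex_succ, Finset.card_union_of_disjoint (disjoint_haarLevel_haarIndex _), ih,
      card_haarLevel_succ, pow_succ, mul_two]

theorem cast_card_haarLevel {J : ℕ} (hJ : 1 ≤ J) : ((haarLevel J).card : ℝ) = 2 ^ J / 2 := by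
  obtain ⟨I, rfl⟩ := Nat.exists_eq_add_of_le' hJ
  rw [card_haarLevel_succ, pow_succ]
  simp

theorem cast_card_haarIndex {J : ℕ} (hJ : 1 ≤ J) : ((haarIndex J).card : ℝ) = 2 ^ J / 2 := by
  obtain ⟨I, rfl⟩ := Nat.exists_eq_add_of_le' hJ
  rw [card_haarIndex_succ, pow_succ]
  simp

theorem nat_div_eq_iff {i d q : ℕ} (hd : 0 < d) : i / d = q ↔ q * d ≤ i ∧ i < (q + 1) * d := by
  rw [← Nat.le_div_iff_mul_le hd, ← Nat.div_lt_iff_lt_mul hd]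
  omega

theorem mul_add_div_eq_of_lt {q d r : ℕ} (hr : r < d) : (q * d + r) / d = q :=
  (nat_div_eq_iff (r.zero_le.trans_lt hr)).2 ⟨by omega, by rw [add_mul, one_mul]; omega⟩

theorem mem_haarPos {J j k i : ℕ} : i + 1 ∈ haarPos J j k ↔ i / 2 ^ (J - j) = 2 * k + 1 := by
  rw [nat_div_eq_iff (by positivity), haarPos, Finset.mem_Icc, add_assoc (2 * k),
    one_add_one_eq_two]
  omega

theorem mem_haarNeg {J j k i : ℕ} : i + 1 ∈ haarNeg J j k ↔ i / 2 ^ (J - j) = 2 * k := by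
  rw [nat_div_eq_iff (by positivity), haarNeg, Finset.mem_Icc]
  omega

/-- The coordinates of `haarVec J (j, k)`, numbered from `0` and extended to a function on `ℕ`;
the supports `I⁺_{j,k}` and `I⁻_{j,k}` are the sets where `⌊i / 2 ^ (J - j)⌋` is `2 k + 1`, resp.
`2 k`. -/
def haarFun (J j k i : ℕ) : ℝ :=
  if j = 0 then 1
  else (2 : ℝ) ^ (((j : ℝ) - 1) / 2) *
    ((if i / 2 ^ (J - j) = 2 * k + 1 then 1 else 0) - (if i / 2 ^ (J - j) = 2 * k then 1 else 0))

theorem haarVec_apply (J j k : ℕ) (i : Fin (2 ^ J)) : haarVec J (j, k) i = haarFun J j k i := by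
  simp only [haarVec, haarFun, mem_haarPos, mem_haarNeg]

theorem sum_fin_ite_div_eq {J d q : ℕ} (hd : d ≤ J) (hq : q < 2 ^ (J - d)) (F : ℕ → ℝ) :
    ∑ i : Fin (2 ^ J), (if (i : ℕ) / 2 ^ d = q then F i else 0) =
      ∑ r ∈ Finset.range (2 ^ d), F (q * 2 ^ d + r) := by
  have hle : (q + 1) * 2 ^ d ≤ 2 ^ J := by
    rw [← Nat.sub_add_cancel hd, pow_add]
    exact Nat.mul_le_mul_right _ hq
  have hblock : (Finset.range (2 ^ J)).filter (fun i => i / 2 ^ d = q) =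
      Finset.Ico (q * 2 ^ d) ((q + 1) * 2 ^ d) := by
    ext i
    rw [Finset.mem_filter, Finset.mem_range, Finset.mem_Ico, nat_div_eq_iff (by positivity)]
    exact ⟨And.right, fun h => ⟨h.2.trans_le hle, h⟩⟩
  rw [Fin.sum_univ_eq_sum_range (fun i => if i / 2 ^ d = q then F i else 0), ← Finset.sum_filter,
    hblock, Finset.sum_Ico_eq_sum_range, add_mul, one_mul, Nat.add_sub_cancel_left]

theorem empInner_haarVec {J j k : ℕ} (hj0 : j ≠ 0) (hj : j ≤ J) (hk : k < 2 ^ (j - 1))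
    (u : EuclideanSpace ℝ (Fin (2 ^ J))) (F : ℕ → ℝ) (hF : ∀ i, u i = F i) :
    empInner u (haarVec J (j, k)) = (2 : ℝ) ^ (((j : ℝ) - 1) / 2) / 2 ^ J *
      ∑ r ∈ Finset.range (2 ^ (J - j)),
        (F ((2 * k + 1) * 2 ^ (J - j) + r) - F (2 * k * 2 ^ (J - j) + r)) := by
  have hk2 : 2 * k + 1 < 2 ^ (J - (J - j)) := by
    rw [Nat.sub_sub_self hj, ← Nat.sub_add_cancel (Nat.one_le_iff_ne_zero.2 hj0), pow_succ]
    omega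
  rw [Finset.sum_sub_distrib, ← sum_fin_ite_div_eq (Nat.sub_le _ _) hk2,
    ← sum_fin_ite_div_eq (Nat.sub_le _ _) (by omega : 2 * k < _), ← Finset.sum_sub_distrib,
    empInner, Finset.mul_sum, Finset.mul_sum]
  refine Finset.sum_congr rfl fun i _ => ?_
  rw [haarVec_apply, hF, haarFun, if_neg hj0, Nat.cast_pow, Nat.cast_ofNat]
  split_ifs <;> ring

theorem two_rpow_half_sq {j : ℕ} (hj0 : j ≠ 0) :
    ((2 : ℝ) ^ (((j : ℝ) - 1) / 2)) ^ 2 = 2 ^ (j - 1) := by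
  rw [← Real.rpow_mul_natCast zero_le_two, ← Real.rpow_natCast,
    Nat.cast_pred (Nat.pos_of_ne_zero hj0)]
  congr 1
  push_cast
  ring

theorem haarFun_upper {J j k r : ℕ} (hj0 : j ≠ 0) (hr : r < 2 ^ (J - j)) :
    haarFun J j k ((2 * k + 1) * 2 ^ (J - j) + r) = (2 : ℝ) ^ (((j : ℝ) - 1) / 2) := by
  simp [haarFun, mul_add_div_eq_of_lt hr, hj0]

theorem haarFun_lower {J j k r : ℕ} (hj0 : j ≠ 0) (hr : r < 2 ^ (J - j)) :
    haarFun J j k (2 * k * 2 ^ (J - j) + r) = -(2 : ℝ) ^ (((j : ℝ) - 1) / 2) := by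
  simp [haarFun, mul_add_div_eq_of_lt hr, hj0]

theorem haarFun_of_ne {J j k k' i : ℕ} (hj0 : j ≠ 0) (hk : i / 2 ^ (J - j) / 2 = k)
    (hkk' : k ≠ k') : haarFun J j k' i = 0 := by
  have hupper : i / 2 ^ (J - j) ≠ 2 * k' + 1 := by omega
  have hlower : i / 2 ^ (J - j) ≠ 2 * k' := by omega
  simp [haarFun, hj0, hupper, hlower]

theorem haarFun_upper_eq_lower_of_lt {J j j' k k' r : ℕ} (hlt : j' < j) (hj : j ≤ J)
    (hr : r < 2 ^ (J - j)) : haarFun J j' k' ((2 * k + 1) * 2 ^ (J - j) + r) =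
      haarFun J j' k' (2 * k * 2 ^ (J - j) + r) := by
  obtain ⟨e, he⟩ : ∃ e, J - j' = (J - j) + (1 + e) := ⟨j - j' - 1, by omega⟩
  have hdiv : ∀ q, (q * 2 ^ (J - j) + r) / 2 ^ (J - j') = q / 2 / 2 ^ e := by
    intro q
    rw [he, pow_add, ← Nat.div_div_eq_div_mul, mul_add_div_eq_of_lt hr, pow_add, pow_one,
      ← Nat.div_div_eq_div_mul]
  have hhalf : (2 * k + 1) / 2 = 2 * k / 2 := by omega
  simp only [haarFun, hdiv, hhalf]

theorem empInner_haarVec_self {J j k : ℕ} (h : (j, k) ∈ haarIndex (J + 1)) :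
    empInner (haarVec J (j, k)) (haarVec J (j, k)) = 1 := by
  obtain ⟨hj, hk⟩ := mem_haarIndex.1 h
  split_ifs at hk with hj0
  · subst hj0
    simp [empInner, haarVec_apply, haarFun]
  · have hterm : ∀ r ∈ Finset.range (2 ^ (J - j)),
        haarFun J j k ((2 * k + 1) * 2 ^ (J - j) + r) - haarFun J j k (2 * k * 2 ^ (J - j) + r) =
          2 * (2 : ℝ) ^ (((j : ℝ) - 1) / 2) := by
      intro r hr
      rw [haarFun_upper hj0 (Finset.mem_range.1 hr), haarFun_lower hj0 (Finset.mem_range.1 hr)]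
      ring
    rw [empInner_haarVec hj0 (by omega) hk _ _ (haarVec_apply J j k), Finset.sum_congr rfl hterm,
      Finset.sum_const, Finset.card_range, nsmul_eq_mul, Nat.cast_pow, Nat.cast_ofNat]
    calc (2 : ℝ) ^ (((j : ℝ) - 1) / 2) / 2 ^ J *
          (2 ^ (J - j) * (2 * (2 : ℝ) ^ (((j : ℝ) - 1) / 2)))
        = ((2 : ℝ) ^ (((j : ℝ) - 1) / 2)) ^ 2 * 2 * 2 ^ (J - j) / 2 ^ J := by ring
      _ = 2 ^ (j - 1 + 1 + (J - j)) / 2 ^ J := by rw [two_rpow_half_sq hj0, pow_add, pow_succ]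
      _ = 1 := by rw [show j - 1 + 1 + (J - j) = J by omega, div_self (by positivity)]

theorem empInner_haarVec_of_fst_lt {J j k j' k' : ℕ} (h : (j, k) ∈ haarIndex (J + 1))
    (hlt : j' < j) : empInner (haarVec J (j', k')) (haarVec J (j, k)) = 0 := by
  obtain ⟨hj, hk⟩ := mem_haarIndex.1 h
  rw [if_neg (by omega)] at hk
  rw [empInner_haarVec (by omega) (by omega) hk _ _ (haarVec_apply J j' k'), Finset.sum_eq_zero,
    mul_zero]
  intro r hr
  rw [haarFun_upper_eq_lower_of_lt hlt (by omega) (Finset.mem_range.1 hr), sub_self]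

theorem empInner_haarVec_of_snd_ne {J j k k' : ℕ} (h : (j, k) ∈ haarIndex (J + 1))
    (h' : (j, k') ∈ haarIndex (J + 1)) (hne : k ≠ k') :
    empInner (haarVec J (j, k')) (haarVec J (j, k)) = 0 := by
  obtain ⟨hj, hk⟩ := mem_haarIndex.1 h
  obtain ⟨-, hk'⟩ := mem_haarIndex.1 h'
  split_ifs at hk hk' with hj0
  · exact absurd (hk.trans hk'.symm) hne
  rw [empInner_haarVec hj0 (by omega) hk _ _ (haarVec_apply J j k'), Finset.sum_eq_zero, mul_zero]
  intro r hr
  have hdiv : ∀ q, (q * 2 ^ (J - j) + r) / 2 ^ (J - j) = q := fun q =>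
    mul_add_div_eq_of_lt (Finset.mem_range.1 hr)
  rw [haarFun_of_ne hj0 (by rw [hdiv]; omega) hne, haarFun_of_ne hj0 (by rw [hdiv]; omega) hne,
    sub_self]

theorem empOrthonormal_haarVec (J : ℕ) : EmpOrthonormal (haarVec J) (haarIndex (J + 1)) := by
  refine ⟨fun a ha => empInner_haarVec_self ha, ?_⟩
  rintro ⟨j, k⟩ ha ⟨j', k'⟩ hb hab
  rcases lt_trichotomy j j' with hlt | rfl | hgt
  · exact empInner_haarVec_of_fst_lt hb hlt
  · exact empInner_haarVec_of_snd_ne hb ha fun hk => hab (by rw [hk])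
  · rw [empInner_comm]
    exact empInner_haarVec_of_fst_lt ha hgt

theorem residualVariance_haarVec {J : ℕ} (hJ : 1 ≤ J) (y : EuclideanSpace ℝ (Fin (2 ^ J))) :
    residualVariance (haarVec J) (haarIndex J) y = haarVariance J y := by
  rw [((empOrthonormal_haarVec J).mono (haarIndex_subset_succ J)).residualVariance_eq,
    haarVariance, cast_card_haarIndex hJ, Nat.cast_pow, Nat.cast_ofNat, sub_half]
  field_simp

theorem haarVariance_eq_sum (J : ℕ) (y : EuclideanSpace ℝ (Fin (2 ^ J))) :
    haarVariance J y = 2 * ∑ a ∈ haarLevel J, empInner y (haarVec J a) ^ 2 := by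
  rw [haarVariance, (empOrthonormal_haarVec J).parseval (card_haarIndex_succ J), haarIndex_succ,
    Finset.sum_union (disjoint_haarLevel_haarIndex J), add_sub_cancel_right]

theorem haarEstimator_eq_sum {J : ℕ} (hJ : 1 ≤ J) (β : ℝ) (y : EuclideanSpace ℝ (Fin (2 ^ J))) :
    haarEstimator J β y = ∑ a ∈ haarIndex J,
      (shrink (Real.exp 1 * 2 ^ J / 2) (2 ^ J * β * empInner y (haarVec J a) ^ 2 / haarVariance J y)
        * empInner y (haarVec J a)) • haarVec J a := by
  rw [haarEstimator, ((empOrthonormal_haarVec J).mono (haarIndex_subset_succ J)).mixingEstimator_eq,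
    residualVariance_haarVec hJ, cast_card_haarIndex hJ, Real.rpow_one, Nat.cast_pow,
    Nat.cast_ofNat, mul_div_assoc (Real.exp 1)]

theorem haarEstimator_eq_haarShrinkage {J : ℕ} (hJ : 1 ≤ J) (β : ℝ)
    (y : EuclideanSpace ℝ (Fin (2 ^ J))) : haarEstimator J β y = haarShrinkage J β y := by
  rw [haarEstimator_eq_sum hJ, haarShrinkage]
  refine Finset.sum_congr rfl fun a _ => ?_
  rw [shrink, mul_comm, ← mul_div_assoc]

theorem haarLoss_eq_sum {J : ℕ} (hJ : 1 ≤ J) (β : ℝ) (μ y : EuclideanSpace ℝ (Fin (2 ^ J))) :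
    haarLoss J β μ y =
      ∑ a ∈ haarIndex J, (empInner μ (haarVec J a) -
        shrink (Real.exp 1 * 2 ^ J / 2)
          (2 ^ J * β * empInner y (haarVec J a) ^ 2 / haarVariance J y) *
          empInner y (haarVec J a)) ^ 2 +
      ∑ a ∈ haarLevel J, empInner μ (haarVec J a) ^ 2 := by
  have hcoarse := (empOrthonormal_haarVec J).mono (haarIndex_subset_succ J)
  rw [haarLoss, (empOrthonormal_haarVec J).parseval (card_haarIndex_succ J), haarIndex_succ,
    Finset.sum_union (disjoint_haarLevel_haarIndex J), add_comm, haarEstimator_eq_sum hJ]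
  congr 1
  · refine Finset.sum_congr rfl fun a ha => ?_
    rw [empInner_sub_left, hcoarse.empInner_sum _ ha]
  · refine Finset.sum_congr rfl fun a ha => ?_
    rw [empInner_sub_left, empInner_sum_left, Finset.sum_eq_zero, sub_zero]
    intro b hb
    rw [empInner_smul_left, (empOrthonormal_haarVec J).2 b (haarIndex_subset_succ J hb) a
      (haarLevel_subset_succ J ha) (Finset.disjoint_left.1 (disjoint_haarLevel_haarIndex J) ha
        |>.imp fun h => h ▸ hb), mul_zero]

end Haar

section BoundedVariation

theorem sum_abs_sub_le_of_eVariationOn_le {α : Type*} [LinearOrder α] {g : α → ℝ} {V : NNReal}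
    (hV : eVariationOn g Set.univ ≤ V) {u : ℕ → α} (hu : Monotone u) (N : ℕ) :
    ∑ i ∈ Finset.range N, |g (u (i + 1)) - g (u i)| ≤ V := by
  have hsum := (eVariationOn.sum_le (n := N) hu fun i => Set.mem_univ (u i)).trans hV
  simp only [edist_dist, Real.dist_eq] at hsum
  rw [← ENNReal.ofReal_sum_of_nonneg fun i _ => abs_nonneg _] at hsum
  exact (ENNReal.ofReal_le_ofReal_iff V.2).1 (hsum.trans_eq ENNReal.ofReal_coe_nnreal.symm)

theorem sum_range_two_mul_le {N : ℕ} {g : ℕ → ℝ} (hg : ∀ i, 0 ≤ g i) :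
    ∑ k ∈ Finset.range N, g (2 * k) ≤ ∑ i ∈ Finset.range (2 * N), g i := by
  rw [← Finset.sum_image (g := (2 * ·)) (f := g) (by simp)]
  refine Finset.sum_le_sum_of_subset_of_nonneg ?_ fun i _ _ => hg i
  intro i
  simp only [Finset.mem_image, Finset.mem_range]
  omega

theorem haarScale_le {j : ℕ} (hj0 : j ≠ 0) :
    (2 : ℝ) ^ (((j : ℝ) - 1) / 2) / 2 ^ j ≤ (√2)⁻¹ ^ j := by
  refine (sq_le_sq₀ (by positivity) (by positivity)).1 ?_
  rw [div_pow, two_rpow_half_sq hj0, pow_right_comm (√2)⁻¹, inv_pow, Real.sq_sqrt zero_le_two,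
    inv_pow, div_le_iff₀ (by positivity), sq, inv_mul_cancel_left₀ (by positivity)]
  exact pow_le_pow_right₀ one_le_two (Nat.sub_le _ _)

theorem sum_abs_empInner_haarVec_le {J j : ℕ} (hj0 : j ≠ 0) (hj : j ≤ J)
    {μ : EuclideanSpace ℝ (Fin (2 ^ J))} {V : NNReal}
    (hV : eVariationOn (fun i => μ i) Set.univ ≤ V) :
    ∑ a ∈ haarLevel j, |empInner μ (haarVec J a)| ≤ V * (√2)⁻¹ ^ j := by
  set d := J - j
  set c := (2 : ℝ) ^ (((j : ℝ) - 1) / 2)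
  let clamp : ℕ → Fin (2 ^ J) := fun i =>
    ⟨min i (2 ^ J - 1), (min_le_right _ _).trans_lt (Nat.sub_lt (by positivity) one_pos)⟩
  have hclamp : Monotone clamp := fun a b hab => Fin.mk_le_mk.2 (min_le_min_right _ hab)
  have hμ : ∀ i, μ i = μ (clamp i) := fun i =>
    congrArg μ (Fin.ext (min_eq_left (Nat.le_sub_one_of_lt i.2)).symm)
  have hcoeff : ∀ k ∈ Finset.range (2 ^ (j - 1)), |empInner μ (haarVec J (j, k))| ≤
      c / 2 ^ J * ∑ r ∈ Finset.range (2 ^ d),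
        |μ (clamp ((2 * k + 1) * 2 ^ d + r)) - μ (clamp (2 * k * 2 ^ d + r))| := by
    intro k hk
    rw [empInner_haarVec hj0 hj (Finset.mem_range.1 hk) _ (fun i => μ (clamp i)) hμ, abs_mul,
      abs_of_pos (by positivity)]
    gcongr
    exact Finset.abs_sum_le_sum_abs _ _
  -- For a fixed offset `r`, the differences sit at disjoint steps of the progression `l 2 ^ d + r`.
  have hoffset : ∀ r ∈ Finset.range (2 ^ d), ∑ k ∈ Finset.range (2 ^ (j - 1)),
      |μ (clamp ((2 * k + 1) * 2 ^ d + r)) - μ (clamp (2 * k * 2 ^ d + r))| ≤ V := by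
    intro r _
    have hmono : Monotone fun l => clamp (l * 2 ^ d + r) := fun a b hab => hclamp (by gcongr)
    exact (sum_range_two_mul_le
      (g := fun l => |μ (clamp ((l + 1) * 2 ^ d + r)) - μ (clamp (l * 2 ^ d + r))|)
      fun _ => abs_nonneg _).trans (sum_abs_sub_le_of_eVariationOn_le hV hmono _)
  rw [haarLevel, if_neg hj0, Finset.sum_product, Finset.sum_singleton]
  calc ∑ k ∈ Finset.range (2 ^ (j - 1)), |empInner μ (haarVec J (j, k))|
      ≤ c / 2 ^ J * ∑ _ ∈ Finset.range (2 ^ d), (V : ℝ) := by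
        refine (Finset.sum_le_sum hcoeff).trans ?_
        rw [← Finset.mul_sum, Finset.sum_comm]
        exact mul_le_mul_of_nonneg_left (Finset.sum_le_sum hoffset) (by positivity)
    _ = V * (c / 2 ^ j) := by
        rw [Finset.sum_const, Finset.card_range, nsmul_eq_mul, Nat.cast_pow, Nat.cast_ofNat,
          show (2 : ℝ) ^ J = 2 ^ d * 2 ^ j by rw [← pow_add, Nat.sub_add_cancel hj]]
        field_simp
    _ ≤ V * (√2)⁻¹ ^ j := by gcongr; exact haarScale_le hj0

theorem eVariationOn_signal_le {n : ℕ} {f : ℝ → ℝ} (hf : BoundedVariationOn f (Set.Icc 0 1))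
    {x : Fin (n + 1) → ℝ} (hx : Monotone x) (hx0 : x 0 = 0) (hx1 : x (Fin.last n) = 1) :
    eVariationOn (fun i => signal f x i) Set.univ ≤ (totalVariation f).toNNReal := by
  rw [totalVariation, ENNReal.toNNReal_toReal_eq, ENNReal.coe_toNNReal hf]
  exact eVariationOn.comp_le_of_monotoneOn f _
    ((hx.comp Fin.strictMono_castSucc.monotone).monotoneOn _)
    fun i _ => ⟨hx0 ▸ hx (Fin.zero_le _), hx1 ▸ hx (Fin.le_last _)⟩

end BoundedVariation

section Gaussian

theorem inv_add_exp_le_exp_neg {A : ℝ} (hA : 0 ≤ A) (t : ℝ) :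
    (A + Real.exp t)⁻¹ ≤ Real.exp (-t) := by
  rw [Real.exp_neg]
  gcongr
  linarith

theorem exp_div_add_exp_sq_le_exp_neg {A : ℝ} (hA : 0 ≤ A) (t : ℝ) :
    Real.exp t / (A + Real.exp t) ^ 2 ≤ Real.exp (-t) := by
  have ht := Real.exp_pos t
  rw [div_le_iff₀ (by positivity), Real.exp_neg, ← div_eq_inv_mul, le_div_iff₀ ht, ← sq]
  gcongr
  linarith

theorem integrable_pow_mul_exp_neg_half_sq (n : ℕ) :
    Integrable fun z : ℝ => z ^ n * Real.exp (-(z ^ 2 / 2)) := by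
  have h := integrable_rpow_mul_exp_neg_mul_sq (b := 1 / 2) (by norm_num) (s := n)
    (by linarith [n.cast_nonneg (α := ℝ)])
  refine h.congr (.of_forall fun z => ?_)
  simp only [Real.rpow_natCast]
  ring_nf

theorem integrable_pow_mul_of_le_exp {g : ℝ → ℝ} (hg : Measurable g) (h0 : ∀ z, 0 ≤ g z)
    (hle : ∀ z, g z ≤ Real.exp (-(z ^ 2 / 2))) (n : ℕ) : Integrable fun z => z ^ n * g z := by
  refine (integrable_pow_mul_exp_neg_half_sq n).mono (by fun_prop) (.of_forall fun z => ?_)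
  rw [norm_mul, norm_mul, Real.norm_of_nonneg (h0 z), Real.norm_of_nonneg (Real.exp_pos _).le]
  gcongr
  exact hle z

theorem integrable_pow_mul_inv_add_exp {A : ℝ} (hA : 0 ≤ A) (n : ℕ) :
    Integrable fun z : ℝ => z ^ n * (A + Real.exp (z ^ 2 / 2))⁻¹ :=
  integrable_pow_mul_of_le_exp (by fun_prop) (fun _ => by positivity)
    (fun _ => inv_add_exp_le_exp_neg hA _) n

theorem integrable_pow_mul_exp_div_add_exp_sq {A : ℝ} (hA : 0 ≤ A) (n : ℕ) :
    Integrable fun z : ℝ =>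
      z ^ n * (Real.exp (z ^ 2 / 2) / (A + Real.exp (z ^ 2 / 2)) ^ 2) :=
  integrable_pow_mul_of_le_exp (by fun_prop) (fun _ => by positivity)
    (fun _ => exp_div_add_exp_sq_le_exp_neg hA _) n

theorem hasDerivAt_neg_inv_add_exp {A : ℝ} (hA : 0 ≤ A) (z : ℝ) :
    HasDerivAt (fun z : ℝ => -(A + Real.exp (z ^ 2 / 2))⁻¹)
      (z * (Real.exp (z ^ 2 / 2) / (A + Real.exp (z ^ 2 / 2)) ^ 2)) z := by
  have hpos : 0 < A + Real.exp (z ^ 2 / 2) := by positivity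
  have h : HasDerivAt (fun z : ℝ => A + Real.exp (z ^ 2 / 2)) (Real.exp (z ^ 2 / 2) * z) z :=
    ((((hasDerivAt_pow 2 z).div_const 2).exp).const_add A).congr_deriv (by simp)
  exact (h.inv hpos.ne').neg.congr_deriv (by rw [neg_div, neg_neg, mul_comm _ z, mul_div_assoc])

-- For `A = 0` this is Stein's recursion for the moments of the standard Gaussian distribution.
theorem integral_pow_add_two_mul_exp_div_add_exp_sq {A : ℝ} (hA : 0 ≤ A) (n : ℕ) :
    ∫ z : ℝ, z ^ (n + 2) * (Real.exp (z ^ 2 / 2) / (A + Real.exp (z ^ 2 / 2)) ^ 2) =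
      (n + 1) * ∫ z : ℝ, z ^ n * (A + Real.exp (z ^ 2 / 2))⁻¹ := by
  have hu (z : ℝ) : HasDerivAt (fun z : ℝ => z ^ (n + 1)) ((n + 1) * z ^ n) z := by
    simpa using hasDerivAt_pow (n + 1) z
  have parts := integral_mul_deriv_eq_deriv_mul_of_integrable (fun z _ => hu z)
    (fun z _ => hasDerivAt_neg_inv_add_exp hA z)
    ((integrable_pow_mul_exp_div_add_exp_sq hA (n + 2)).congr
      (.of_forall fun z => by simp only [Pi.mul_apply]; ring))
    (((integrable_pow_mul_inv_add_exp hA n).const_mul (-(n + 1))).congr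
      (.of_forall fun z => by simp only [Pi.mul_apply]; ring))
    ((integrable_pow_mul_inv_add_exp hA (n + 1)).neg.congr
      (.of_forall fun z => by simp only [Pi.mul_apply, Pi.neg_apply]; ring))
  rw [← integral_neg] at parts
  simp only [pow_succ _ (n + 1), mul_assoc, mul_neg, neg_neg, integral_const_mul] at parts ⊢
  exact parts

theorem gaussianPDFReal_zero_one (z : ℝ) :
    gaussianPDFReal 0 1 z = (√(2 * Real.pi))⁻¹ * Real.exp (-(z ^ 2 / 2)) := by
  simp [gaussianPDFReal_def, neg_div]

theorem integrable_pow_gaussianReal (μ : ℝ) (v : NNReal) (n : ℕ) :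
    Integrable (fun z => z ^ n) (gaussianReal μ v) := by
  have h0 : 0 ∈ interior (integrableExpSet id (gaussianReal μ v)) := by
    simp [integrableExpSet_id_gaussianReal]
  exact integrable_pow_of_mem_interior_integrableExpSet h0 n

theorem integral_pow_add_two_gaussianReal (n : ℕ) :
    ∫ z, z ^ (n + 2) ∂gaussianReal 0 1 = (n + 1) * ∫ z, z ^ n ∂gaussianReal 0 1 := by
  have h := integral_pow_add_two_mul_exp_div_add_exp_sq le_rfl n
  have hw (z : ℝ) :
      Real.exp (z ^ 2 / 2) / Real.exp (z ^ 2 / 2) ^ 2 = Real.exp (-(z ^ 2 / 2)) := by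
    rw [Real.exp_neg]
    field_simp
  simp only [zero_add, hw, ← Real.exp_neg] at h
  simp only [integral_gaussianReal_eq_integral_smul one_ne_zero, gaussianPDFReal_zero_one,
    smul_eq_mul, mul_assoc, integral_const_mul, mul_comm (Real.exp _), h]
  ring

theorem integral_sq_gaussianReal (θ : ℝ) : ∫ z, z ^ 2 ∂gaussianReal θ 1 = θ ^ 2 + 1 := by
  have h := variance_eq_sub (memLp_id_gaussianReal (μ := θ) (v := 1) 2)
  simp only [variance_id_gaussianReal, id_eq, Pi.pow_apply, integral_id_gaussianReal,
    NNReal.coe_one] at h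
  linarith

theorem integral_pow_four_gaussianReal_le (θ : ℝ) :
    ∫ z, z ^ 4 ∂gaussianReal θ 1 ≤ 8 * (θ ^ 4 + 3) := by
  have hI := integrable_pow_gaussianReal 0 1 4
  have h4 : ∫ z, z ^ 4 ∂gaussianReal 0 1 = 3 := by
    rw [integral_pow_add_two_gaussianReal 2, integral_sq_gaussianReal]
    norm_num
  have hmap := gaussianReal_map_const_add (μ := 0) (v := 1) θ
  rw [zero_add] at hmap
  rw [← hmap, integral_map (by fun_prop) (by fun_prop)]
  calc ∫ z, (θ + z) ^ 4 ∂gaussianReal 0 1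
      ≤ ∫ z, 8 * (θ ^ 4 + z ^ 4) ∂gaussianReal 0 1 := by
        refine integral_mono ?_ (((integrable_const _).add hI).const_mul 8) fun z => ?_
        · exact (hmap ▸ integrable_pow_gaussianReal θ 1 4).comp_measurable (measurable_const_add θ)
        · exact (Even.add_pow_le (n := 4) (by decide) (a := θ) (b := z)).trans_eq (by norm_num)
    _ = 8 * (θ ^ 4 + 3) := by
        rw [integral_const_mul, integral_add (integrable_const _) hI, h4]
        simp

theorem integral_exp_mul_id_gaussianReal (t : ℝ) :
    ∫ z, Real.exp (t * z) ∂gaussianReal 0 1 = Real.exp (t ^ 2 / 2) := by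
  simpa [mgf] using congrFun (mgf_fun_id_gaussianReal (μ := 0) (v := 1)) t

theorem tilted_gaussianReal (t : ℝ) :
    (gaussianReal 0 1).tilted (t * ·) = gaussianReal t 1 := by
  rw [Measure.tilted, integral_exp_mul_id_gaussianReal, gaussianReal_of_var_ne_zero _ one_ne_zero,
    gaussianReal_of_var_ne_zero _ one_ne_zero, ← withDensity_mul _ (by fun_prop) (by fun_prop)]
  congr 1
  ext z
  rw [Pi.mul_apply, gaussianPDF, gaussianPDF, ← ENNReal.ofReal_mul (gaussianPDFReal_nonneg _ _ _),
    gaussianPDFReal_zero_one, gaussianPDFReal_def, mul_assoc, ← Real.exp_sub, ← Real.exp_add]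
  simp only [NNReal.coe_one, mul_one]
  ring_nf

theorem integrable_exp_mul_mul_gaussianReal_iff {h : ℝ → ℝ} {t : ℝ} :
    Integrable (fun z => Real.exp (t * z) * h z) (gaussianReal 0 1) ↔
      Integrable h (gaussianReal t 1) := by
  rw [← tilted_gaussianReal t, integrable_tilted_iff (integrable_exp_mul_gaussianReal t)]
  simp only [smul_eq_mul]

theorem integral_exp_mul_mul_gaussianReal (h : ℝ → ℝ) (t : ℝ) :
    ∫ z, Real.exp (t * z) * h z ∂gaussianReal 0 1 =
      Real.exp (t ^ 2 / 2) * ∫ z, h z ∂gaussianReal t 1 := by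
  rw [← tilted_gaussianReal t, integral_tilted, integral_exp_mul_id_gaussianReal,
    ← integral_const_mul]
  congr 1
  ext z
  rw [smul_eq_mul]
  field_simp

section Even

variable {h : ℝ → ℝ} {θ : ℝ}

theorem integrable_gaussianReal_neg (he : ∀ z, h (-z) = h z)
    (hh : Integrable h (gaussianReal θ 1)) : Integrable h (gaussianReal (-θ) 1) := by
  rw [← gaussianReal_map_neg]
  refine ((MeasurableEquiv.neg ℝ).measurableEmbedding.integrable_map_iff).2 (hh.congr ?_)
  exact .of_forall fun z => (he z).symm

theorem integral_gaussianReal_neg (he : ∀ z, h (-z) = h z) (θ : ℝ) :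
    ∫ z, h z ∂gaussianReal (-θ) 1 = ∫ z, h z ∂gaussianReal θ 1 := by
  rw [← gaussianReal_map_neg]
  refine ((MeasurableEquiv.neg ℝ).measurableEmbedding.integral_map h).trans ?_
  exact integral_congr_ae (.of_forall he)

theorem mul_cosh_eq_exp (h : ℝ → ℝ) (θ z : ℝ) : h z * Real.cosh (θ * z) =
    2⁻¹ * (Real.exp (θ * z) * h z + Real.exp (-θ * z) * h z) := by
  rw [Real.cosh_eq, neg_mul]
  ring

theorem integrable_mul_cosh_gaussianReal (he : ∀ z, h (-z) = h z)
    (hh : Integrable h (gaussianReal θ 1)) :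
    Integrable (fun z => h z * Real.cosh (θ * z)) (gaussianReal 0 1) := by
  simp only [mul_cosh_eq_exp]
  exact ((integrable_exp_mul_mul_gaussianReal_iff.2 hh).add
    (integrable_exp_mul_mul_gaussianReal_iff.2 (integrable_gaussianReal_neg he hh))).const_mul _

theorem integral_mul_cosh_gaussianReal (he : ∀ z, h (-z) = h z)
    (hh : Integrable h (gaussianReal θ 1)) :
    ∫ z, h z * Real.cosh (θ * z) ∂gaussianReal 0 1 =
      Real.exp (θ ^ 2 / 2) * ∫ z, h z ∂gaussianReal θ 1 := by
  simp only [mul_cosh_eq_exp]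
  rw [integral_const_mul, integral_add (integrable_exp_mul_mul_gaussianReal_iff.2 hh)
    (integrable_exp_mul_mul_gaussianReal_iff.2 (integrable_gaussianReal_neg he hh)),
    integral_exp_mul_mul_gaussianReal, integral_exp_mul_mul_gaussianReal,
    integral_gaussianReal_neg he, neg_sq]
  ring

end Even

theorem cosh_le_one_add (x : ℝ) : Real.cosh x ≤ 1 + x ^ 2 / 2 * Real.cosh x := by
  suffices Real.cosh x * (1 - x ^ 2 / 2) ≤ 1 by linarith
  calc Real.cosh x * (1 - x ^ 2 / 2)
      ≤ Real.cosh x * Real.exp (-(x ^ 2 / 2)) := by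
        gcongr
        linarith [Real.add_one_le_exp (-(x ^ 2 / 2))]
    _ ≤ Real.exp (x ^ 2 / 2) * Real.exp (-(x ^ 2 / 2)) := by
        gcongr
        exact Real.cosh_le_exp_half_sq x
    _ = 1 := by rw [← Real.exp_add, add_neg_cancel, Real.exp_zero]

theorem integral_even_gaussianReal_le {h : ℝ → ℝ} (hm : Measurable h) (he : ∀ z, h (-z) = h z)
    (h0 : ∀ z, 0 ≤ h z) (h2 : ∀ z, h z ≤ z ^ 2) (θ : ℝ) :
    ∫ z, h z ∂gaussianReal θ 1 ≤ ∫ z, h z ∂gaussianReal 0 1 +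
      θ ^ 2 / 2 * ∫ z, z ^ 4 ∂gaussianReal θ 1 := by
  have hI (t : ℝ) : Integrable h (gaussianReal t 1) :=
    (integrable_pow_gaussianReal t 1 2).mono' hm.aestronglyMeasurable (.of_forall fun z => by
      rw [Real.norm_of_nonneg (h0 z)]
      exact h2 z)
  have h4 (z : ℝ) : h z * z ^ 2 ≤ z ^ 4 := by nlinarith [h2 z, sq_nonneg z]
  have hI2 : Integrable (fun z => h z * z ^ 2) (gaussianReal θ 1) :=
    (integrable_pow_gaussianReal θ 1 4).mono' (by fun_prop) (.of_forall fun z => by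
      rw [Real.norm_of_nonneg (mul_nonneg (h0 z) (sq_nonneg z))]
      exact h4 z)
  have he2 (z : ℝ) : h (-z) * (-z) ^ 2 = h z * z ^ 2 := by rw [he, neg_sq]
  have hcosh : Real.exp (θ ^ 2 / 2) * ∫ z, h z ∂gaussianReal θ 1 ≤ ∫ z, h z ∂gaussianReal 0 1 +
      θ ^ 2 / 2 * (Real.exp (θ ^ 2 / 2) * ∫ z, h z * z ^ 2 ∂gaussianReal θ 1) := by
    have hJ := integrable_mul_cosh_gaussianReal he2 hI2
    rw [← integral_mul_cosh_gaussianReal he (hI θ), ← integral_mul_cosh_gaussianReal he2 hI2,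
      ← integral_const_mul, ← integral_add (hI 0) (hJ.const_mul _)]
    refine integral_mono (integrable_mul_cosh_gaussianReal he (hI θ))
      ((hI 0).add (hJ.const_mul _)) fun z => ?_
    calc h z * Real.cosh (θ * z)
        ≤ h z * (1 + (θ * z) ^ 2 / 2 * Real.cosh (θ * z)) :=
          mul_le_mul_of_nonneg_left (cosh_le_one_add _) (h0 z)
      _ = h z + θ ^ 2 / 2 * (h z * z ^ 2 * Real.cosh (θ * z)) := by ring
  have hexp : 1 ≤ Real.exp (θ ^ 2 / 2) := Real.one_le_exp (by positivity)
  have hnn : 0 ≤ ∫ z, h z ∂gaussianReal 0 1 := integral_nonneg h0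
  have hmono : ∫ z, h z * z ^ 2 ∂gaussianReal θ 1 ≤ ∫ z, z ^ 4 ∂gaussianReal θ 1 :=
    integral_mono hI2 (integrable_pow_gaussianReal θ 1 4) h4
  refine le_of_mul_le_mul_left (hcosh.trans ?_) (Real.exp_pos (θ ^ 2 / 2))
  nlinarith [mul_le_mul_of_nonneg_left hmono (by positivity : 0 ≤ θ ^ 2 / 2 * Real.exp (θ ^ 2 / 2)),
    mul_le_mul_of_nonneg_right hexp hnn]

end Gaussian

section UniversalThreshold

variable {A : ℝ}

theorem inv_add_exp_le (hA : Real.exp 1 ≤ A) (t : ℝ) :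
    (A + Real.exp t)⁻¹ ≤ Real.exp 1 / A * Real.exp (-(t / Real.log A)) := by
  have hA0 : 0 < A := (Real.exp_pos 1).trans_le hA
  have hL : 1 ≤ Real.log A := by rwa [Real.le_log_iff_exp_le hA0]
  have hL0 : 0 < Real.log A := by linarith
  have ht := Real.exp_pos t
  suffices A * Real.exp (t / Real.log A) ≤ Real.exp 1 * (A + Real.exp t) by
    rw [Real.exp_neg, inv_le_iff_one_le_mul₀ (by positivity), div_mul_eq_mul_div,
      ← div_eq_mul_inv, div_div, div_mul_eq_mul_div, le_div_iff₀ (by positivity), one_mul, mul_comm]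
    exact this
  rcases le_total t (Real.log A) with h | h
  · have hdiv : Real.exp (t / Real.log A) ≤ Real.exp 1 :=
      Real.exp_le_exp.2 ((div_le_one hL0).2 h)
    nlinarith [mul_le_mul_of_nonneg_left hdiv hA0.le, mul_pos (Real.exp_pos 1) ht]
  · have hexp : Real.log A + t / Real.log A ≤ 1 + t := by
      have : t / Real.log A - 1 ≤ t - Real.log A := by
        rw [div_sub_one hL0.ne', div_le_iff₀ hL0]
        nlinarith
      linarith
    calc A * Real.exp (t / Real.log A)
        = Real.exp (Real.log A + t / Real.log A) := by rw [Real.exp_add, Real.exp_log hA0]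
      _ ≤ Real.exp (1 + t) := Real.exp_le_exp.2 hexp
      _ ≤ Real.exp 1 * (A + Real.exp t) := by
          rw [Real.exp_add]
          gcongr
          linarith

theorem integral_inv_add_exp_le (hA : Real.exp 1 ≤ A) :
    ∫ z : ℝ, (A + Real.exp (z ^ 2 / 2))⁻¹ ≤
      Real.exp 1 / A * √(2 * Real.pi * Real.log A) := by
  have hA0 : 0 < A := (Real.exp_pos 1).trans_le hA
  have hL : 1 ≤ Real.log A := by rwa [Real.le_log_iff_exp_le hA0]
  have hb : 0 < 1 / (2 * Real.log A) := by positivity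
  calc ∫ z : ℝ, (A + Real.exp (z ^ 2 / 2))⁻¹
      ≤ ∫ z : ℝ, Real.exp 1 / A * Real.exp (-(1 / (2 * Real.log A)) * z ^ 2) := by
        refine integral_mono (by simpa using integrable_pow_mul_inv_add_exp hA0.le 0)
          ((integrable_exp_neg_mul_sq hb).const_mul _) fun z => ?_
        refine (inv_add_exp_le hA _).trans_eq ?_
        congr 2
        field_simp
    _ = Real.exp 1 / A * √(2 * Real.pi * Real.log A) := by
        rw [integral_const_mul, integral_gaussian]
        congr 2
        field_simp

theorem integral_sq_mul_shrink_sq_le (hA : Real.exp 1 ≤ A) :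
    ∫ z, z ^ 2 * shrink A (z ^ 2 / 2) ^ 2 ∂gaussianReal 0 1 ≤ Real.exp 1 * Real.log A / A := by
  have hA0 : 0 < A := (Real.exp_pos 1).trans_le hA
  have hL : 1 ≤ Real.log A := by rwa [Real.le_log_iff_exp_le hA0]
  have hparts := integral_pow_add_two_mul_exp_div_add_exp_sq hA0.le 0
  simp only [zero_add, CharP.cast_eq_zero, pow_zero, one_mul] at hparts
  have hdensity (z : ℝ) : gaussianPDFReal 0 1 z • (z ^ 2 * shrink A (z ^ 2 / 2) ^ 2) =
      (√(2 * Real.pi))⁻¹ *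
        (z ^ 2 * (Real.exp (z ^ 2 / 2) / (A + Real.exp (z ^ 2 / 2)) ^ 2)) := by
    rw [gaussianPDFReal_zero_one, smul_eq_mul, shrink, Real.exp_neg]
    field_simp
  calc ∫ z, z ^ 2 * shrink A (z ^ 2 / 2) ^ 2 ∂gaussianReal 0 1
      = (√(2 * Real.pi))⁻¹ * ∫ z : ℝ, (A + Real.exp (z ^ 2 / 2))⁻¹ := by
        simp only [integral_gaussianReal_eq_integral_smul one_ne_zero, hdensity,
          integral_const_mul, hparts]
    _ ≤ (√(2 * Real.pi))⁻¹ * (Real.exp 1 / A * √(2 * Real.pi * Real.log A)) := by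
        gcongr
        exact integral_inv_add_exp_le hA
    _ = Real.exp 1 * √(Real.log A) / A := by
        rw [Real.sqrt_mul (by positivity : 0 ≤ 2 * Real.pi)]
        have : 0 < √(2 * Real.pi) := by positivity
        field_simp
    _ ≤ Real.exp 1 * Real.log A / A := by
        gcongr
        exact (Real.sqrt_le_left (by linarith)).2 (by nlinarith)

theorem integral_sq_mul_shrink_sq_shift_le (hA : Real.exp 1 ≤ A) (θ : ℝ) :
    ∫ z, z ^ 2 * shrink A (z ^ 2 / 2) ^ 2 ∂gaussianReal θ 1 ≤
      16 * θ ^ 2 + Real.exp 1 * Real.log A / A := by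
  have hA0 : 0 < A := (Real.exp_pos 1).trans_le hA
  have hA1 : 1 ≤ A := (Real.one_le_exp zero_le_one).trans hA
  have hlog := Real.log_nonneg hA1
  have hleak : 0 ≤ Real.exp 1 * Real.log A / A := by positivity
  have hm := measurable_shrink A
  have hle (z : ℝ) : z ^ 2 * shrink A (z ^ 2 / 2) ^ 2 ≤ z ^ 2 :=
    mul_le_of_le_one_right (sq_nonneg z)
      (pow_le_one₀ (shrink_nonneg hA0.le _) (shrink_le_one hA0.le _))
  rcases le_total 1 (θ ^ 2) with hθ | hθ
  · calc ∫ z, z ^ 2 * shrink A (z ^ 2 / 2) ^ 2 ∂gaussianReal θ 1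
        ≤ ∫ z, z ^ 2 ∂gaussianReal θ 1 :=
          integral_mono_of_nonneg (.of_forall fun z => by positivity)
            (integrable_pow_gaussianReal θ 1 2) (.of_forall hle)
      _ = θ ^ 2 + 1 := integral_sq_gaussianReal θ
      _ ≤ _ := by linarith
  · calc ∫ z, z ^ 2 * shrink A (z ^ 2 / 2) ^ 2 ∂gaussianReal θ 1
        ≤ ∫ z, z ^ 2 * shrink A (z ^ 2 / 2) ^ 2 ∂gaussianReal 0 1 +
            θ ^ 2 / 2 * ∫ z, z ^ 4 ∂gaussianReal θ 1 :=
          integral_even_gaussianReal_le (by fun_prop) (fun z => by rw [neg_sq])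
            (fun z => by positivity) hle θ
      _ ≤ Real.exp 1 * Real.log A / A + θ ^ 2 / 2 * (8 * (θ ^ 4 + 3)) := by
          gcongr
          · exact integral_sq_mul_shrink_sq_le hA
          · exact integral_pow_four_gaussianReal_le θ
      _ ≤ 16 * θ ^ 2 + Real.exp 1 * Real.log A / A := by
          nlinarith [mul_le_mul_of_nonneg_right hθ (sq_nonneg θ),
            mul_nonneg (sq_nonneg θ) (sq_nonneg θ)]

end UniversalThreshold

section GaussianForms

variable {Ω ι κ : Type*} [MeasurableSpace Ω] {P : Measure Ω} [Fintype ι] {ε : ι → Ω → ℝ}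

theorem hasGaussianLaw_linear_forms [Finite κ] (hε : ∀ i, HasLaw (ε i) (gaussianReal 0 1) P)
    (hind : iIndepFun ε P) (w : κ → ι → ℝ) :
    HasGaussianLaw (fun ω a => ∑ i, w a i * ε i ω) P := by
  have := Fintype.ofFinite κ
  let T : (ι → ℝ) →L[ℝ] (κ → ℝ) :=
    ContinuousLinearMap.pi fun a => ∑ i, w a i • ContinuousLinearMap.proj (R := ℝ) i
  have hT := (iIndepFun.hasGaussianLaw (fun i => (hε i).hasGaussianLaw) hind).map_fun T
  simpa [T] using hT

variable [IsProbabilityMeasure P]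

theorem covariance_linear_forms (hε : ∀ i, HasLaw (ε i) (gaussianReal 0 1) P)
    (hind : iIndepFun ε P) (u w : ι → ℝ) :
    cov[fun ω => ∑ i, u i * ε i ω, fun ω => ∑ i, w i * ε i ω; P] = ∑ i, u i * w i := by
  have hmem (i : ι) : MemLp (ε i) 2 P := (hε i).hasGaussianLaw.memLp_two
  rw [covariance_fun_sum_fun_sum (fun i => (hmem i).const_mul _) (fun i => (hmem i).const_mul _)]
  refine Finset.sum_congr rfl fun i _ => ?_
  simp only [covariance_const_mul_left, covariance_const_mul_right]
  rw [Finset.sum_eq_single_of_mem i (Finset.mem_univ i)]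
  · rw [covariance_self (hε i).aemeasurable, (hε i).variance_eq, variance_id_gaussianReal,
      NNReal.coe_one, mul_one, mul_comm]
  · intro j _ hji
    rw [(hind.indepFun hji.symm).covariance_eq_zero (hmem i) (hmem j), mul_zero, mul_zero]

theorem hasLaw_linear_form (hε : ∀ i, HasLaw (ε i) (gaussianReal 0 1) P) (hind : iIndepFun ε P)
    (w : ι → ℝ) :
    HasLaw (fun ω => ∑ i, w i * ε i ω) (gaussianReal 0 (∑ i, w i * w i).toNNReal) P := by
  have hG := (hasGaussianLaw_linear_forms hε hind fun _ : Unit => w).eval ()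
  refine ⟨hG.aemeasurable, ?_⟩
  have hmean : ∫ ω, ∑ i, w i * ε i ω ∂P = 0 := by
    rw [integral_finsetSum _ fun i _ => (hε i).hasGaussianLaw.integrable.const_mul _]
    refine Finset.sum_eq_zero fun i _ => ?_
    rw [integral_const_mul, (hε i).integral_eq, integral_id_gaussianReal, mul_zero]
  rw [hG.map_eq_gaussianReal, hmean, ← covariance_self hG.aemeasurable,
    covariance_linear_forms hε hind]

theorem iIndepFun_linear_forms [Finite κ] (hε : ∀ i, HasLaw (ε i) (gaussianReal 0 1) P)
    (hind : iIndepFun ε P) {w : κ → ι → ℝ} (hw : Pairwise fun a b => ∑ i, w a i * w b i = 0) :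
    iIndepFun (fun a ω => ∑ i, w a i * ε i ω) P := by
  refine (hasGaussianLaw_linear_forms hε hind w).iIndepFun_of_covariance_eq_zero fun a b hab => ?_
  rw [covariance_linear_forms hε hind, hw hab]

end GaussianForms

section EmpiricalCoefficients

variable {Ω : Type*} {n : ℕ}

theorem empInner_observation (μ u : EuclideanSpace ℝ (Fin n)) (σ : ℝ) (ε : Fin n → Ω → ℝ) (ω : Ω) :
    empInner (observation μ σ ε ω) u = empInner μ u + ∑ i, σ / n * u i * ε i ω := by
  simp only [empInner, observation, add_mul, Finset.sum_add_distrib, mul_add, Finset.mul_sum]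
  congr 1
  exact Finset.sum_congr rfl fun i _ => by ring

theorem sum_scaled_mul (σ : ℝ) (u w : EuclideanSpace ℝ (Fin n)) :
    ∑ i, σ / n * u i * (σ / n * w i) = σ ^ 2 / n * empInner u w := by
  rw [empInner, Finset.mul_sum, Finset.mul_sum]
  exact Finset.sum_congr rfl fun i _ => by ring

variable {ι : Type*} [MeasurableSpace Ω] {P : Measure Ω} [IsProbabilityMeasure P]
  {ε : Fin n → Ω → ℝ} {v : ι → EuclideanSpace ℝ (Fin n)} {Λ : Finset ι}

theorem EmpOrthonormal.hasLaw_observation (hv : EmpOrthonormal v Λ)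
    (hε : ∀ i, HasLaw (ε i) (gaussianReal 0 1) P) (hind : iIndepFun ε P)
    (μ : EuclideanSpace ℝ (Fin n)) (σ : ℝ) {a : ι} (ha : a ∈ Λ) :
    HasLaw (fun ω => empInner (observation μ σ ε ω) (v a))
      (gaussianReal (empInner μ (v a)) (σ ^ 2 / n).toNNReal) P := by
  have h := gaussianReal_const_add (hasLaw_linear_form hε hind fun i => σ / n * v a i)
    (empInner μ (v a))
  rw [sum_scaled_mul, hv.1 a ha, mul_one, zero_add] at h
  simpa only [empInner_observation] using h

theorem EmpOrthonormal.iIndepFun_observation (hv : EmpOrthonormal v Λ)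
    (hε : ∀ i, HasLaw (ε i) (gaussianReal 0 1) P) (hind : iIndepFun ε P)
    (μ : EuclideanSpace ℝ (Fin n)) (σ : ℝ) :
    iIndepFun (fun (a : Λ) ω => empInner (observation μ σ ε ω) (v a)) P := by
  have hw : Pairwise fun a b : Λ => ∑ i, σ / n * v a i * (σ / n * v b i) = 0 := fun a b hab => by
    beta_reduce
    rw [sum_scaled_mul, hv.2 a a.2 b b.2 (Subtype.coe_injective.ne hab), mul_zero]
  simpa only [empInner_observation, Function.comp_def] using
    (iIndepFun_linear_forms hε hind hw).comp (fun a z => empInner μ (v a) + z) fun a => by fun_prop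

end EmpiricalCoefficients

section LowerTail

theorem integral_exp_neg_mul_sq_gaussianReal_le {t : ℝ} (ht : 0 ≤ t) (η : ℝ) :
    ∫ z, Real.exp (-t * z ^ 2) ∂gaussianReal η 1 ≤ √(1 / (1 + 2 * t)) := by
  set c := η / (1 + 2 * t) with hc
  have hpdf (z : ℝ) : gaussianPDFReal η 1 z • Real.exp (-t * z ^ 2) ≤
      (√(2 * Real.pi))⁻¹ * Real.exp (-(t + 1 / 2) * (z - c) ^ 2) := by
    have hsq : -(z - η) ^ 2 / 2 + -t * z ^ 2 =
        -(t + 1 / 2) * (z - c) ^ 2 - t * η ^ 2 / (1 + 2 * t) := by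
      rw [hc]
      field_simp
      ring
    have hη : 0 ≤ t * η ^ 2 / (1 + 2 * t) := by positivity
    simp only [gaussianPDFReal_def, NNReal.coe_one, mul_one, smul_eq_mul]
    rw [mul_assoc, ← Real.exp_add, hsq]
    gcongr
    linarith
  calc ∫ z, Real.exp (-t * z ^ 2) ∂gaussianReal η 1
      ≤ ∫ z, (√(2 * Real.pi))⁻¹ * Real.exp (-(t + 1 / 2) * (z - c) ^ 2) := by
        rw [integral_gaussianReal_eq_integral_smul one_ne_zero]
        exact integral_mono_of_nonneg
          (.of_forall fun z => smul_nonneg (gaussianPDFReal_nonneg _ _ _) (Real.exp_pos _).le)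
          (((integrable_exp_neg_mul_sq (by linarith)).comp_sub_right c).const_mul _)
          (.of_forall hpdf)
    _ = √(1 / (1 + 2 * t)) := by
        rw [integral_const_mul,
          integral_sub_right_eq_self (fun z : ℝ => Real.exp (-(t + 1 / 2) * z ^ 2)),
          integral_gaussian, ← Real.sqrt_inv, ← Real.sqrt_mul (by positivity)]
        congr 1
        have := Real.pi_pos
        field_simp
        ring

variable {Ω κ : Type*} [MeasurableSpace Ω] {P : Measure Ω}

theorem hasLaw_div_sqrt {Z : Ω → ℝ} {θ : ℝ} {v : NNReal} (hv : v ≠ 0)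
    (hZ : HasLaw Z (gaussianReal θ v) P) :
    HasLaw (fun ω => Z ω / √v) (gaussianReal (θ / √v) 1) P := by
  have h := gaussianReal_div_const hZ √v
  have hvar : v / NNReal.mk (√v ^ 2) (sq_nonneg _) = 1 := by
    have hsq : NNReal.mk (√v ^ 2) (sq_nonneg _) = v := NNReal.eq (Real.sq_sqrt v.2)
    rw [hsq, div_self hv]
  rwa [hvar] at h

theorem mgf_sum_sq_le {ξ : κ → Ω → ℝ} {η : κ → ℝ}
    (hξ : ∀ a, HasLaw (ξ a) (gaussianReal (η a) 1) P) (hind : iIndepFun ξ P) (S : Finset κ)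
    {t : ℝ} (ht : 0 ≤ t) :
    mgf (fun ω => ∑ a ∈ S, ξ a ω ^ 2) P (-t) ≤ √(1 / (1 + 2 * t)) ^ S.card := by
  have hsq : iIndepFun (fun a ω => ξ a ω ^ 2) P := hind.comp (fun _ z => z ^ 2) fun _ => by fun_prop
  have hmgf (a : κ) : mgf (fun ω => ξ a ω ^ 2) P (-t) ≤ √(1 / (1 + 2 * t)) :=
    ((hξ a).integral_comp (f := fun z => Real.exp (-t * z ^ 2)) (by fun_prop)).trans_le
      (integral_exp_neg_mul_sq_gaussianReal_le ht (η a))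
  have hsum := hsq.mgf_sum₀ (fun a => (hξ a).aemeasurable.pow_const 2) S (t := -t)
  rw [Finset.sum_fn] at hsum
  rw [hsum, ← Finset.prod_const]
  exact Finset.prod_le_prod (fun a _ => mgf_nonneg) fun a _ => hmgf a

variable [IsProbabilityMeasure P]

-- Chernoff's method at the optimal exponent `t = (1 / x - 1) / 2`, for which `1 / (1 + 2 t) = x`.
theorem measure_sum_sq_le_card_mul {ξ : κ → Ω → ℝ} {η : κ → ℝ}
    (hξ : ∀ a, HasLaw (ξ a) (gaussianReal (η a) 1) P) (hind : iIndepFun ξ P) (S : Finset κ)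
    {x : ℝ} (hx0 : 0 < x) (hx1 : x ≤ 1) :
    P.real {ω | ∑ a ∈ S, ξ a ω ^ 2 ≤ S.card * x} ≤ Real.exp (-(S.card * phi x)) := by
  set t := (1 / x - 1) / 2 with ht
  have ht0 : 0 ≤ t := by
    have := one_le_one_div hx0 hx1
    rw [ht]
    linarith
  have hsqrt : √(1 / (1 + 2 * t)) = Real.exp (Real.log x / 2) := by
    rw [show 1 / (1 + 2 * t) = x by rw [ht]; field_simp; ring, ← Real.log_sqrt hx0.le,
      Real.exp_log (by positivity)]
  have hint : Integrable (fun ω => Real.exp (-t * ∑ a ∈ S, ξ a ω ^ 2)) P := by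
    have hm (a : κ) := (hξ a).aemeasurable
    refine (integrable_const (1 : ℝ)).mono' (AEMeasurable.aestronglyMeasurable (by fun_prop))
      (.of_forall fun ω => ?_)
    rw [Real.norm_of_nonneg (Real.exp_pos _).le, Real.exp_le_one_iff, neg_mul, neg_nonpos]
    exact mul_nonneg ht0 (Finset.sum_nonneg fun a _ => sq_nonneg _)
  calc P.real {ω | ∑ a ∈ S, ξ a ω ^ 2 ≤ S.card * x}
      ≤ Real.exp (-(-t) * (S.card * x)) * mgf (fun ω => ∑ a ∈ S, ξ a ω ^ 2) P (-t) :=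
        measure_le_le_exp_mul_mgf _ (neg_nonpos.2 ht0) hint
    _ ≤ Real.exp (-(-t) * (S.card * x)) * Real.exp (Real.log x / 2) ^ S.card := by
        gcongr
        exact hsqrt ▸ mgf_sum_sq_le hξ hind S ht0
    _ = Real.exp (-(S.card * phi x)) := by
        rw [← Real.exp_nat_mul, ← Real.exp_add, phi, ht]
        congr 1
        field_simp
        ring

theorem measure_sum_sq_le_card_mul_variance {Z : κ → Ω → ℝ} {θ : κ → ℝ} {v : NNReal} (hv : v ≠ 0)
    (hZ : ∀ a, HasLaw (Z a) (gaussianReal (θ a) v) P) (hind : iIndepFun Z P) (S : Finset κ)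
    {x : ℝ} (hx0 : 0 < x) (hx1 : x ≤ 1) :
    P.real {ω | ∑ a ∈ S, Z a ω ^ 2 ≤ S.card * x * v} ≤ Real.exp (-(S.card * phi x)) := by
  have hv0 : (0 : ℝ) < v := by positivity
  have h := measure_sum_sq_le_card_mul (fun a => hasLaw_div_sqrt hv (hZ a))
    (hind.comp (fun _ z => z / √v) fun _ => by fun_prop) S hx0 hx1
  simpa only [div_pow, Real.sq_sqrt hv0.le, ← Finset.sum_div, div_le_iff₀ hv0] using h

end LowerTail

section CoordinateRisk

theorem sq_sub_shrink_mul_le_threshold {A c s : ℝ} (hA : 1 ≤ A) (hc : 0 < c) (hs : 0 < s)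
    (θ z : ℝ) :
    (θ - shrink A (c * z ^ 2 / s) * z) ^ 2 ≤
      2 * (z - θ) ^ 2 + 2 * (Real.log A + 1) / c * s := by
  have hA0 : 0 ≤ A := by linarith
  set g := shrink A (c * z ^ 2 / s) with hg
  have hg0 : 0 ≤ g := shrink_nonneg hA0 _
  have hg1 : g ≤ 1 := shrink_le_one hA0 _
  have hbias : z ^ 2 * (1 - g) ≤ (Real.log A + 1) / c * s := by
    have h := mul_one_sub_shrink_le hA (c * z ^ 2 / s)
    rw [← hg, div_mul_eq_mul_div, div_le_iff₀ hs] at h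
    rw [div_mul_eq_mul_div, le_div_iff₀ hc]
    linarith
  calc (θ - g * z) ^ 2 = ((1 - g) * z - (z - θ)) ^ 2 := by ring
    _ ≤ 2 * (z - θ) ^ 2 + 2 * (z ^ 2 * (1 - g) * (1 - g)) := by
        nlinarith [sq_nonneg ((1 - g) * z + (z - θ))]
    _ ≤ 2 * (z - θ) ^ 2 + 2 * (z ^ 2 * (1 - g)) := by
        have := mul_nonneg (sq_nonneg z) (sub_nonneg.2 hg1)
        linarith [mul_le_of_le_one_right this (sub_le_self 1 hg0)]
    _ ≤ 2 * (z - θ) ^ 2 + 2 * (Real.log A + 1) / c * s := by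
        rw [mul_div_assoc, mul_assoc 2]
        gcongr

theorem sq_sub_shrink_mul_le_signal {A c v : ℝ} (hA : 0 ≤ A) (hc : 0 < c) (hv : 0 < v)
    (s θ z : ℝ) :
    (θ - shrink A (c * z ^ 2 / s) * z) ^ 2 ≤
      2 * θ ^ 2 + 2 * (z ^ 2 * (Set.Iic (2 * c * v)).indicator 1 s) +
        2 * (z ^ 2 * shrink A (z ^ 2 / (2 * v)) ^ 2) := by
  set g := shrink A (c * z ^ 2 / s)
  have hg0 : 0 ≤ g := shrink_nonneg hA _
  have hg1 : g ≤ 1 := shrink_le_one hA _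
  have hle : g ^ 2 ≤ (Set.Iic (2 * c * v)).indicator 1 s + shrink A (z ^ 2 / (2 * v)) ^ 2 := by
    by_cases hs : s ≤ 2 * c * v
    · rw [Set.indicator_of_mem (Set.mem_Iic.2 hs), Pi.one_apply]
      exact (pow_le_one₀ hg0 hg1).trans (le_add_of_nonneg_right (sq_nonneg _))
    · rw [Set.indicator_of_notMem (Set.mem_Iic.not.2 hs), zero_add]
      refine pow_le_pow_left₀ hg0 (shrink_mono hA ?_) 2
      calc c * z ^ 2 / s ≤ c * z ^ 2 / (2 * c * v) := by
            gcongr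
            exact (not_le.1 hs).le
        _ = z ^ 2 / (2 * v) := by field_simp
  nlinarith [sq_nonneg (θ + g * z), mul_le_mul_of_nonneg_left hle (sq_nonneg z)]

variable {Ω : Type*} [MeasurableSpace Ω] {P : Measure Ω} {Z s : Ω → ℝ} {θ : ℝ} {v : NNReal}

theorem integral_sub_sq_eq_variance_of_hasLaw (hZ : HasLaw Z (gaussianReal θ v) P) :
    ∫ ω, (Z ω - θ) ^ 2 ∂P = v := by
  have h := hZ.variance_eq
  rwa [variance_eq_integral hZ.aemeasurable, hZ.integral_eq, integral_id_gaussianReal,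
    variance_id_gaussianReal] at h

theorem integral_sq_mul_shrink_sq_le_of_hasLaw (hZ : HasLaw Z (gaussianReal θ v) P) (hv : v ≠ 0)
    {A : ℝ} (hA : Real.exp 1 ≤ A) :
    ∫ ω, Z ω ^ 2 * shrink A (Z ω ^ 2 / (2 * v)) ^ 2 ∂P ≤
      16 * θ ^ 2 + v * (Real.exp 1 * Real.log A / A) := by
  have hv0 : (0 : ℝ) < v := by positivity
  have hg := measurable_shrink A
  have hscale (z : ℝ) : z ^ 2 * shrink A (z ^ 2 / (2 * v)) ^ 2 =
      v * ((z / √v) ^ 2 * shrink A ((z / √v) ^ 2 / 2) ^ 2) := by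
    rw [div_pow, Real.sq_sqrt hv0.le, div_div, mul_comm (v : ℝ) 2]
    field_simp
  have hlaw := (hasLaw_div_sqrt hv hZ).integral_comp
    (f := fun z => z ^ 2 * shrink A (z ^ 2 / 2) ^ 2) (by fun_prop)
  calc ∫ ω, Z ω ^ 2 * shrink A (Z ω ^ 2 / (2 * v)) ^ 2 ∂P
      = v * ∫ z, z ^ 2 * shrink A (z ^ 2 / 2) ^ 2 ∂gaussianReal (θ / √v) 1 := by
        simp only [hscale, integral_const_mul]
        exact congrArg _ hlaw
    _ ≤ v * (16 * (θ / √v) ^ 2 + Real.exp 1 * Real.log A / A) := by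
        gcongr
        exact integral_sq_mul_shrink_sq_shift_le hA _
    _ = 16 * θ ^ 2 + v * (Real.exp 1 * Real.log A / A) := by
        rw [div_pow, Real.sq_sqrt hv0.le]
        field_simp

theorem integral_sq_mul_indicator_of_indepFun (hind : IndepFun Z s P) (hZ : AEMeasurable Z P)
    (hs : AEMeasurable s P) (r : ℝ) :
    ∫ ω, Z ω ^ 2 * (Set.Iic r).indicator 1 (s ω) ∂P =
      (∫ ω, Z ω ^ 2 ∂P) * P.real {ω | s ω ≤ r} := by
  have hm : Measurable ((Set.Iic r).indicator (1 : ℝ → ℝ)) :=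
    measurable_one.indicator measurableSet_Iic
  have hprob : ∫ ω, (Set.Iic r).indicator 1 (s ω) ∂P = P.real {ω | s ω ≤ r} :=
    (integral_indicator₀ (f := 1) (hs.nullMeasurableSet_preimage measurableSet_Iic)).trans
      (by simp [Set.preimage])
  rw [← hprob]
  exact (hind.comp (measurable_id.pow_const 2) hm).integral_fun_mul_eq_mul_integral
    (hZ.pow_const 2).aestronglyMeasurable (hm.comp_aemeasurable hs).aestronglyMeasurable

variable [IsProbabilityMeasure P]

theorem integral_sq_of_hasLaw (hZ : HasLaw Z (gaussianReal θ v) P) :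
    ∫ ω, Z ω ^ 2 ∂P = θ ^ 2 + v := by
  have h := hZ.variance_eq
  rw [variance_eq_sub hZ.hasGaussianLaw.memLp_two, hZ.integral_eq, integral_id_gaussianReal,
    variance_id_gaussianReal, sub_eq_iff_eq_add'] at h
  exact h

theorem integrable_sq_sub_shrink_mul (hZ : MemLp Z 2 P) {u : Ω → ℝ} (hu : AEMeasurable u P)
    {A : ℝ} (hA : 0 ≤ A) (θ : ℝ) :
    Integrable (fun ω => (θ - shrink A (u ω) * Z ω) ^ 2) P := by
  have hm := hZ.aestronglyMeasurable.aemeasurable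
  have hg := measurable_shrink A
  refine ((memLp_const θ).sub (hZ.mono (AEMeasurable.aestronglyMeasurable (by fun_prop))
    (.of_forall fun ω => ?_))).integrable_sq
  rw [norm_mul, Real.norm_of_nonneg (shrink_nonneg hA _)]
  exact mul_le_of_le_one_left (norm_nonneg _) (shrink_le_one hA _)

theorem integral_sq_sub_shrink_mul_le_threshold (hZ : HasLaw Z (gaussianReal θ v) P)
    (hs : Integrable s P) (hspos : ∀ᵐ ω ∂P, 0 < s ω) {A c : ℝ} (hA : 1 ≤ A) (hc : 0 < c) :
    ∫ ω, (θ - shrink A (c * Z ω ^ 2 / s ω) * Z ω) ^ 2 ∂P ≤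
      2 * v + 2 * (Real.log A + 1) / c * ∫ ω, s ω ∂P := by
  have hZ2 : MemLp Z 2 P := hZ.hasGaussianLaw.memLp_two
  have hm := hZ.aemeasurable
  have hsm := hs.aemeasurable
  have hnoise : Integrable (fun ω => 2 * (Z ω - θ) ^ 2) P :=
    (hZ2.sub (memLp_const θ)).integrable_sq.const_mul 2
  rw [← integral_sub_sq_eq_variance_of_hasLaw hZ, ← integral_const_mul, ← integral_const_mul,
    ← integral_add hnoise (hs.const_mul _)]
  refine integral_mono_ae (integrable_sq_sub_shrink_mul hZ2 (by fun_prop) (by linarith) θ)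
    (hnoise.add (hs.const_mul _)) ?_
  filter_upwards [hspos] with ω hω using sq_sub_shrink_mul_le_threshold hA hc hω θ (Z ω)

theorem integral_sq_sub_shrink_mul_le_signal (hZ : HasLaw Z (gaussianReal θ v) P) (hv : v ≠ 0)
    (hs : AEMeasurable s P) (hind : IndepFun Z s P) {A c : ℝ} (hA : Real.exp 1 ≤ A) (hc : 0 < c) :
    ∫ ω, (θ - shrink A (c * Z ω ^ 2 / s ω) * Z ω) ^ 2 ∂P ≤
      34 * θ ^ 2 + 2 * ((θ ^ 2 + v) * P.real {ω | s ω ≤ 2 * c * v}) +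
        2 * (v * (Real.exp 1 * Real.log A / A)) := by
  have hA0 : 0 ≤ A := (Real.exp_pos 1).le.trans hA
  have hZ2 : MemLp Z 2 P := hZ.hasGaussianLaw.memLp_two
  have hm := hZ.aemeasurable
  have hg := measurable_shrink A
  have hi : Measurable ((Set.Iic (2 * c * v)).indicator (1 : ℝ → ℝ)) :=
    measurable_one.indicator measurableSet_Iic
  have hdamp {w : Ω → ℝ} (hw : AEMeasurable w P) (h0 : ∀ ω, 0 ≤ w ω) (h1 : ∀ ω, w ω ≤ 1) :
      Integrable (fun ω => 2 * (Z ω ^ 2 * w ω)) P :=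
    (hZ2.integrable_sq.mul_bdd (c := 1) hw.aestronglyMeasurable (.of_forall fun ω => by
      rw [Real.norm_of_nonneg (h0 ω)]; exact h1 ω)).const_mul 2
  have hlow : Integrable (fun ω => 2 * (Z ω ^ 2 * (Set.Iic (2 * c * v)).indicator 1 (s ω))) P :=
    hdamp (by fun_prop) (fun ω => Set.indicator_nonneg (fun _ _ => zero_le_one) _)
      fun ω => Set.indicator_le_self' (fun _ _ => zero_le_one) _
  have huniv : Integrable (fun ω => 2 * (Z ω ^ 2 * shrink A (Z ω ^ 2 / (2 * v)) ^ 2)) P :=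
    hdamp (by fun_prop) (fun ω => sq_nonneg _)
      fun ω => pow_le_one₀ (shrink_nonneg hA0 _) (shrink_le_one hA0 _)
  calc ∫ ω, (θ - shrink A (c * Z ω ^ 2 / s ω) * Z ω) ^ 2 ∂P
      ≤ ∫ ω, (2 * θ ^ 2 + 2 * (Z ω ^ 2 * (Set.Iic (2 * c * v)).indicator 1 (s ω)) +
          2 * (Z ω ^ 2 * shrink A (Z ω ^ 2 / (2 * v)) ^ 2)) ∂P :=
        integral_mono (integrable_sq_sub_shrink_mul hZ2 (by fun_prop) hA0 θ)
          (((integrable_const _).add hlow).add huniv)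
          fun ω => sq_sub_shrink_mul_le_signal hA0 hc (by positivity) (s ω) θ (Z ω)
    _ = 2 * θ ^ 2 + 2 * ((θ ^ 2 + v) * P.real {ω | s ω ≤ 2 * c * v}) +
          2 * ∫ ω, Z ω ^ 2 * shrink A (Z ω ^ 2 / (2 * v)) ^ 2 ∂P := by
        rw [integral_add (f := fun ω => 2 * θ ^ 2 + _) ((integrable_const _).add hlow) huniv,
          integral_add (integrable_const _) hlow, integral_const, probReal_univ, one_smul,
          integral_const_mul, integral_const_mul, integral_sq_mul_indicator_of_indepFun hind hm hs,
          integral_sq_of_hasLaw hZ]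
    _ ≤ _ := by linarith [integral_sq_mul_shrink_sq_le_of_hasLaw hZ hv hA]

end CoordinateRisk

section OracleInequality

theorem log_exp_one_mul_div_two_le {N : ℝ} (hN : 0 < N) :
    Real.log (Real.exp 1 * N / 2) ≤ 1 + Real.log N := by
  rw [Real.log_div (by positivity) two_ne_zero, Real.log_mul (by positivity) hN.ne', Real.log_exp]
  linarith [Real.log_nonneg one_le_two]

theorem two_le_log {N : ℝ} (hN : 8 ≤ N) : 2 ≤ Real.log N := by
  rw [Real.le_log_iff_exp_le (by linarith)]
  calc Real.exp 2 = Real.exp 1 ^ 2 := by rw [← Real.exp_nat_mul]; norm_num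
    _ ≤ 2.7182818286 ^ 2 := by gcongr; exact Real.exp_one_lt_d9.le
    _ ≤ N := by norm_num at hN ⊢; linarith

variable {Ω : Type*} [MeasurableSpace Ω] {P : Measure Ω} [IsProbabilityMeasure P] {Z s : Ω → ℝ}
  {θ N σ β S : ℝ}

theorem integral_sq_sub_shrink_mul_le_mul_threshold (hN : 8 ≤ N) (hβ0 : 0 < β) (hβ : β ≤ 1 / 2)
    (hZ : HasLaw Z (gaussianReal θ (σ ^ 2 / N).toNNReal) P) (hs : Integrable s P)
    (hspos : ∀ᵐ ω ∂P, 0 < s ω) (hσS : σ ^ 2 ≤ S) (hsS : ∫ ω, s ω ∂P ≤ S) :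
    ∫ ω, (θ - shrink (Real.exp 1 * N / 2) (N * β * Z ω ^ 2 / s ω) * Z ω) ^ 2 ∂P ≤
      5 * (S * Real.log N / (N * β)) := by
  have hN0 : 0 < N := by linarith
  have hL := two_le_log hN
  have : 0 ≤ S := (sq_nonneg σ).trans hσS
  have hA : 1 ≤ Real.exp 1 * N / 2 := by nlinarith [Real.add_one_le_exp 1]
  have hlogA := log_exp_one_mul_div_two_le hN0
  have hvar : 2 * (σ ^ 2 / N) ≤ S * Real.log N / (N * β) := by
    rw [← mul_div_assoc, div_le_div_iff₀ hN0 (by positivity)]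
    have : 2 * β * σ ^ 2 ≤ Real.log N * S :=
      mul_le_mul (by linarith) hσS (sq_nonneg σ) (by linarith)
    nlinarith
  have hthr : 2 * (Real.log (Real.exp 1 * N / 2) + 1) / (N * β) * ∫ ω, s ω ∂P ≤
      4 * (S * Real.log N / (N * β)) := by
    calc _ ≤ 4 * Real.log N / (N * β) * S :=
          mul_le_mul (div_le_div_of_nonneg_right (by linarith) (by positivity)) hsS
            (integral_nonneg_of_ae (hspos.mono fun _ h => h.le)) (by positivity)
      _ = _ := by ring
  have h := integral_sq_sub_shrink_mul_le_threshold hZ hs hspos hA (mul_pos hN0 hβ0)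
  rw [Real.coe_toNNReal _ (by positivity)] at h
  linarith

theorem integral_sq_sub_shrink_mul_le_mul_signal (hN : 8 ≤ N) (hσ : 0 < σ) (hβ0 : 0 < β)
    (hZ : HasLaw Z (gaussianReal θ (σ ^ 2 / N).toNNReal) P) (hs : AEMeasurable s P)
    (hind : IndepFun Z s P) (hlow : P.real {ω | s ω ≤ 2 * β * σ ^ 2} ≤ 2 / N) :
    ∫ ω, (θ - shrink (Real.exp 1 * N / 2) (N * β * Z ω ^ 2 / s ω) * Z ω) ^ 2 ∂P ≤
      35 * θ ^ 2 + 8 * Real.log N * σ ^ 2 / N ^ 2 := by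
  have hN0 : 0 < N := by linarith
  have hL := two_le_log hN
  have hA : Real.exp 1 ≤ Real.exp 1 * N / 2 := by nlinarith [Real.exp_pos 1]
  have hv : (σ ^ 2 / N).toNNReal ≠ 0 := (Real.toNNReal_pos.2 (by positivity)).ne'
  have h := integral_sq_sub_shrink_mul_le_signal hZ hv hs hind hA (mul_pos hN0 hβ0)
  rw [Real.coe_toNNReal _ (by positivity),
    show 2 * (N * β) * (σ ^ 2 / N) = 2 * β * σ ^ 2 by field_simp] at h
  have hmiss : (θ ^ 2 + σ ^ 2 / N) * P.real {ω | s ω ≤ 2 * β * σ ^ 2} ≤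
      1 / 4 * θ ^ 2 + 2 * (σ ^ 2 / N ^ 2) := by
    have h2N : 2 / N ≤ 1 / 4 := by
      rw [div_le_div_iff₀ hN0 (by norm_num)]
      linarith
    calc _ ≤ (θ ^ 2 + σ ^ 2 / N) * (2 / N) := by gcongr
      _ = 2 / N * θ ^ 2 + 2 * (σ ^ 2 / N ^ 2) := by field_simp
      _ ≤ _ := by gcongr
  have hleak : σ ^ 2 / N * (Real.exp 1 * Real.log (Real.exp 1 * N / 2) / (Real.exp 1 * N / 2)) ≤
      2 * (1 + Real.log N) * (σ ^ 2 / N ^ 2) := by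
    calc _ = 2 * Real.log (Real.exp 1 * N / 2) * (σ ^ 2 / N ^ 2) := by field_simp
      _ ≤ _ := by gcongr; exact log_exp_one_mul_div_two_le hN0
  have hlog : 2 * (σ ^ 2 / N ^ 2) ≤ Real.log N * (σ ^ 2 / N ^ 2) := by gcongr
  rw [mul_div_assoc (8 * Real.log N)]
  linarith [sq_nonneg θ]

end OracleInequality

section RateCalculus

theorem sum_Ico_inv_sqrt_two_pow_le (a b : ℕ) :
    ∑ j ∈ Finset.Ico a b, (√2)⁻¹ ^ j ≤ 4 * (√2)⁻¹ ^ a := by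
  have hρ : (√2)⁻¹ ≤ 3 / 4 := by
    rw [inv_le_comm₀ (by positivity) (by norm_num)]
    exact Real.le_sqrt_of_sq_le (by norm_num)
  refine (geom_sum_Ico_le_of_lt_one (by positivity) (by linarith)).trans ?_
  rw [div_le_iff₀ (by linarith)]
  nlinarith [pow_nonneg (inv_nonneg.2 (Real.sqrt_nonneg 2)) a]

theorem sum_min_two_pow_le {b : ℝ} (hb : 0 ≤ b) (a J : ℕ) :
    ∑ j ∈ Finset.range J, min (2 ^ j) (b * (√2)⁻¹ ^ j) ≤ 2 ^ a - 1 + 4 * (b * (√2)⁻¹ ^ a) := by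
  calc ∑ j ∈ Finset.range J, min (2 ^ j) (b * (√2)⁻¹ ^ j)
      ≤ ∑ j ∈ Finset.range (a + J), min (2 ^ j) (b * (√2)⁻¹ ^ j) :=
        Finset.sum_le_sum_of_subset_of_nonneg (Finset.range_mono (Nat.le_add_left J a))
          fun _ _ _ => by positivity
    _ = ∑ j ∈ Finset.range a, min (2 ^ j) (b * (√2)⁻¹ ^ j) +
          ∑ j ∈ Finset.Ico a (a + J), min (2 ^ j) (b * (√2)⁻¹ ^ j) :=
        (Finset.sum_range_add_sum_Ico _ (Nat.le_add_right a J)).symm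
    _ ≤ ∑ j ∈ Finset.range a, 2 ^ j + ∑ j ∈ Finset.Ico a (a + J), b * (√2)⁻¹ ^ j :=
        add_le_add (Finset.sum_le_sum fun _ _ => min_le_left _ _)
          (Finset.sum_le_sum fun _ _ => min_le_right _ _)
    _ ≤ 2 ^ a - 1 + 4 * (b * (√2)⁻¹ ^ a) := by
        rw [geom_sum_eq (by norm_num), ← Finset.mul_sum, mul_left_comm]
        norm_num only [div_one]
        gcongr
        exact sum_Ico_inv_sqrt_two_pow_le _ _

-- Cut the sum where the two sequences cross, at `2 ^ j = c ^ 2`.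
theorem sum_min_two_pow_le_sq {c : ℝ} (hc : 0 ≤ c) (J : ℕ) :
    ∑ j ∈ Finset.range J, min (2 ^ j) (c ^ 3 * (√2)⁻¹ ^ j) ≤ 6 * c ^ 2 := by
  have hc3 : 0 ≤ c ^ 3 := by positivity
  rcases le_total c 1 with hc1 | hc1
  · have h := sum_min_two_pow_le hc3 0 J
    simp only [pow_zero, sub_self, zero_add, mul_one] at h
    nlinarith [mul_le_mul_of_nonneg_left hc1 (sq_nonneg c)]
  · obtain ⟨m, hm, hm'⟩ := exists_nat_pow_near (one_le_pow₀ hc1 : 1 ≤ c ^ 2) one_lt_two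
    have hρ : (√2)⁻¹ ^ (m + 1) ≤ c⁻¹ := by
      rw [inv_pow]
      refine inv_anti₀ (by positivity) ((sq_le_sq₀ hc (by positivity)).1 ?_)
      rw [← pow_mul, mul_comm, pow_mul, Real.sq_sqrt two_pos.le]
      exact hm'.le
    have hcut : c ^ 3 * (√2)⁻¹ ^ (m + 1) ≤ c ^ 2 :=
      (mul_le_mul_of_nonneg_left hρ hc3).trans_eq (by field_simp)
    have h := sum_min_two_pow_le hc3 (m + 1) J
    rw [pow_succ (2 : ℝ) m] at h
    linarith

theorem sum_min_two_pow_mul_le_rpow {V D : ℝ} (hV : 0 ≤ V) (hD : 0 < D) (J : ℕ) :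
    ∑ j ∈ Finset.range J, min (2 ^ j * D) (V * √D * (√2)⁻¹ ^ j) ≤
      6 * (V * D) ^ ((2 : ℝ) / 3) := by
  obtain ⟨s, hs, rfl⟩ : ∃ s, 0 < s ∧ D = s ^ 2 := ⟨√D, by positivity, (Real.sq_sqrt hD.le).symm⟩
  obtain ⟨c, hc, rfl⟩ : ∃ c, 0 ≤ c ∧ V = c ^ 3 * s := by
    refine ⟨(V / s) ^ (3⁻¹ : ℝ), by positivity, ?_⟩
    rw [← Real.rpow_natCast, ← Real.rpow_mul (by positivity)]
    norm_num
    field_simp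
  have hrpow : (c ^ 3 * s * s ^ 2) ^ ((2 : ℝ) / 3) = (c * s) ^ 2 := by
    rw [show c ^ 3 * s * s ^ 2 = (c * s) ^ 3 by ring, ← Real.rpow_natCast,
      ← Real.rpow_mul (by positivity)]
    norm_num
  rw [hrpow, Real.sqrt_sq hs.le]
  calc ∑ j ∈ Finset.range J, min (2 ^ j * s ^ 2) (c ^ 3 * s * s * (√2)⁻¹ ^ j)
      = (∑ j ∈ Finset.range J, min (2 ^ j) (c ^ 3 * (√2)⁻¹ ^ j)) * s ^ 2 := by
        rw [Finset.sum_mul]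
        refine Finset.sum_congr rfl fun j _ => ?_
        rw [min_mul_of_nonneg _ _ (sq_nonneg s)]
        ring_nf
    _ ≤ 6 * c ^ 2 * s ^ 2 := by gcongr; exact sum_min_two_pow_le_sq hc J
    _ = 6 * (c * s) ^ 2 := by ring

theorem log_sq_le_four_mul {N : ℝ} (hN : 1 ≤ N) : Real.log N ^ 2 ≤ 4 * N := by
  have hN0 : 0 < N := by linarith
  have hL : Real.log N ≤ 2 * √N := by
    have h := Real.log_le_sub_one_of_pos (Real.sqrt_pos.2 hN0)
    rw [Real.log_sqrt hN0.le] at h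
    linarith
  calc Real.log N ^ 2 ≤ (2 * √N) ^ 2 := pow_le_pow_left₀ (Real.log_nonneg hN) hL 2
    _ = 4 * N := by rw [mul_pow, Real.sq_sqrt hN0.le]; norm_num

theorem rpow_two_thirds_le_of_sq_le_cube {x y : ℝ} (hx : 0 ≤ x) (hy : 0 ≤ y)
    (h : x ^ 2 ≤ y ^ 3) : x ^ ((2 : ℝ) / 3) ≤ y := by
  have hcube : (x ^ ((2 : ℝ) / 3)) ^ 3 = x ^ 2 := by
    rw [← Real.rpow_natCast, ← Real.rpow_mul hx]
    norm_num
  exact le_of_pow_le_pow_left₀ three_ne_zero hy (hcube.trans_le h)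

theorem rpow_two_thirds_variance_le {V σ N β : ℝ} (hV : 0 ≤ V) (hN : 1 ≤ N) (hβ : 0 < β)
    (hβ1 : β ≤ 1) :
    (V * ((σ ^ 2 + 2 * (V ^ 2 / N)) * Real.log N / (N * β))) ^ ((2 : ℝ) / 3) ≤
      1 / β * ((V * σ ^ 2 * Real.log N / N) ^ ((2 : ℝ) / 3) + 4 * (V ^ 2 / N)) := by
  have : 0 < N := by linarith
  have hL : 0 ≤ Real.log N := Real.log_nonneg hN
  set a := V * σ ^ 2 * Real.log N / N with ha
  set b := 2 * V ^ 3 * Real.log N / N ^ 2 with hb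
  have ha0 : 0 ≤ a := by positivity
  have hb0 : 0 ≤ b := by positivity
  have hab : V * ((σ ^ 2 + 2 * (V ^ 2 / N)) * Real.log N / (N * β)) = (a + b) / β := by
    rw [ha, hb]
    field_simp
  have hb23 : b ^ ((2 : ℝ) / 3) ≤ 4 * (V ^ 2 / N) := by
    refine rpow_two_thirds_le_of_sq_le_cube hb0 (by positivity) ?_
    calc b ^ 2 = 4 * V ^ 6 / N ^ 4 * Real.log N ^ 2 := by rw [hb]; ring
      _ ≤ 4 * V ^ 6 / N ^ 4 * (4 * N) := by gcongr; exact log_sq_le_four_mul hN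
      _ = 16 * (V ^ 6 / N ^ 3) := by field_simp; ring
      _ ≤ 64 * (V ^ 6 / N ^ 3) := by gcongr; norm_num
      _ = (4 * (V ^ 2 / N)) ^ 3 := by ring
  have hβ23 : β ≤ β ^ ((2 : ℝ) / 3) := by
    simpa only [Real.rpow_one] using
      Real.rpow_le_rpow_of_exponent_ge hβ hβ1 (by norm_num : (2 : ℝ) / 3 ≤ 1)
  calc _ = 1 / β ^ ((2 : ℝ) / 3) * (a + b) ^ ((2 : ℝ) / 3) := by
        rw [hab, Real.div_rpow (by positivity) hβ.le, one_div_mul_eq_div]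
    _ ≤ 1 / β * (a ^ ((2 : ℝ) / 3) + b ^ ((2 : ℝ) / 3)) := by
        gcongr
        exact Real.rpow_add_le_add_rpow ha0 hb0 (by norm_num) (by norm_num)
    _ ≤ 1 / β * (a ^ ((2 : ℝ) / 3) + 4 * (V ^ 2 / N)) := by gcongr

theorem variance_mul_log_div_le {V σ N β : ℝ} (hN : 1 ≤ N) (hβ : 0 < β) :
    (σ ^ 2 + 2 * (V ^ 2 / N)) * Real.log N / (N * β) ≤
      1 / β * (σ ^ 2 * Real.log N / N + 2 * (V ^ 2 / N)) := by
  have hN0 : 0 < N := by linarith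
  have hL : Real.log N / N ≤ 1 := by
    rw [div_le_one hN0]
    linarith [Real.log_le_sub_one_of_pos hN0]
  calc _ = 1 / β * (σ ^ 2 * Real.log N / N + 2 * (V ^ 2 / N) * (Real.log N / N)) := by field_simp
    _ ≤ _ := by
        have hV := mul_le_of_le_one_right (by positivity : 0 ≤ 2 * (V ^ 2 / N)) hL
        gcongr

theorem oracle_bound_le_rate {V σ N β : ℝ} (hV : 0 ≤ V) (hN : 1 ≤ N) (hβ : 0 < β)
    (hβ1 : β ≤ 1) :
    35 * ((σ ^ 2 + 2 * (V ^ 2 / N)) * Real.log N / (N * β) +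
        6 * (V * ((σ ^ 2 + 2 * (V ^ 2 / N)) * Real.log N / (N * β))) ^ ((2 : ℝ) / 3)) +
      4 * (σ ^ 2 * Real.log N / N) + V ^ 2 / N ≤
    1160 / β * max ((V * σ ^ 2 * Real.log N / N) ^ ((2 : ℝ) / 3))
      (max (V ^ 2 / N) (σ ^ 2 * Real.log N / N)) := by
  have hD := variance_mul_log_div_le (V := V) (σ := σ) hN hβ
  have hVD := rpow_two_thirds_variance_le (σ := σ) hV hN hβ hβ1
  have hlog : 0 ≤ Real.log N := Real.log_nonneg hN
  have hinv : 1 ≤ 1 / β := (one_le_div hβ).2 hβ1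
  set M₁ := (V * σ ^ 2 * Real.log N / N) ^ ((2 : ℝ) / 3)
  set M₂ := V ^ 2 / N
  set M₃ := σ ^ 2 * Real.log N / N
  set M := max M₁ (max M₂ M₃)
  have h₁ : M₁ ≤ M := le_max_left _ _
  have h₂ : M₂ ≤ M := (le_max_left _ _).trans (le_max_right _ _)
  have h₃ : M₃ ≤ M := (le_max_right _ _).trans (le_max_right _ _)
  have htail : 4 * M₃ + M₂ ≤ 1 / β * (4 * M₃ + M₂) :=
    le_mul_of_one_le_left (by positivity) hinv
  calc _ ≤ 35 * (1 / β * (M₃ + 2 * M₂) + 6 * (1 / β * (M₁ + 4 * M₂))) +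
        1 / β * (4 * M₃ + M₂) := by linarith
    _ = 1 / β * (210 * M₁ + 911 * M₂ + 39 * M₃) := by ring
    _ ≤ 1 / β * (1160 * M) := by gcongr; linarith
    _ = 1160 / β * M := by ring

end RateCalculus

section PhiInv

theorem phiInv_mem_Ioo {y : ℝ} (hy : 0 < y) : phiInv y ∈ Set.Ioo (0 : ℝ) 1 :=
  phi_bijOn.surjOn.mapsTo_invFunOn hy

theorem phi_phiInv {y : ℝ} (hy : 0 < y) : phi (phiInv y) = y :=
  phi_bijOn.surjOn.rightInvOn_invFunOn hy

theorem two_mul_log_half_div_pos {N : ℝ} (hN : 2 < N) : 0 < 2 * Real.log (N / 2) / N := by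
  have := Real.log_pos (by linarith : 1 < N / 2)
  positivity

theorem exp_neg_half_mul_phi_phiInv {N : ℝ} (hN : 2 < N) :
    Real.exp (-(N / 2 * phi (phiInv (2 * Real.log (N / 2) / N)))) = 2 / N := by
  rw [phi_phiInv (two_mul_log_half_div_pos hN),
    show N / 2 * (2 * Real.log (N / 2) / N) = Real.log (N / 2) by field_simp, Real.exp_neg,
    Real.exp_log (by linarith), inv_div]

end PhiInv

section HaarCoefficients

variable {Ω : Type*} [MeasurableSpace Ω] {P : Measure Ω} [IsProbabilityMeasure P] {J : ℕ}
  {ε : Fin (2 ^ J) → Ω → ℝ}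

theorem hasLaw_empInner_haarVec (hε : ∀ i, HasLaw (ε i) (gaussianReal 0 1) P)
    (hind : iIndepFun ε P) (μ : EuclideanSpace ℝ (Fin (2 ^ J))) (σ : ℝ) {a : ℕ × ℕ}
    (ha : a ∈ haarIndex (J + 1)) :
    HasLaw (fun ω => empInner (observation μ σ ε ω) (haarVec J a))
      (gaussianReal (empInner μ (haarVec J a)) (σ ^ 2 / 2 ^ J).toNNReal) P := by
  simpa only [Nat.cast_pow, Nat.cast_ofNat] using
    (empOrthonormal_haarVec J).hasLaw_observation hε hind μ σ ha

theorem integrable_haarVariance (hε : ∀ i, HasLaw (ε i) (gaussianReal 0 1) P)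
    (hind : iIndepFun ε P) (μ : EuclideanSpace ℝ (Fin (2 ^ J))) (σ : ℝ) :
    Integrable (fun ω => haarVariance J (observation μ σ ε ω)) P := by
  simp_rw [haarVariance_eq_sum]
  exact (integrable_finsetSum _ fun a ha => (hasLaw_empInner_haarVec hε hind μ σ
    (haarLevel_subset_succ J ha)).hasGaussianLaw.memLp_two.integrable_sq).const_mul 2

theorem integral_haarVariance (hJ : 1 ≤ J) (hε : ∀ i, HasLaw (ε i) (gaussianReal 0 1) P)
    (hind : iIndepFun ε P) (μ : EuclideanSpace ℝ (Fin (2 ^ J))) (σ : ℝ) :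
    ∫ ω, haarVariance J (observation μ σ ε ω) ∂P =
      σ ^ 2 + 2 * ∑ a ∈ haarLevel J, empInner μ (haarVec J a) ^ 2 := by
  have hlaw := fun a (ha : a ∈ haarLevel J) =>
    hasLaw_empInner_haarVec hε hind μ σ (haarLevel_subset_succ J ha)
  simp_rw [haarVariance_eq_sum]
  rw [integral_const_mul, integral_finsetSum _ fun a ha =>
      (hlaw a ha).hasGaussianLaw.memLp_two.integrable_sq,
    Finset.sum_congr rfl fun a ha => integral_sq_of_hasLaw (hlaw a ha), Finset.sum_add_distrib,
    Finset.sum_const, nsmul_eq_mul, cast_card_haarLevel hJ, Real.coe_toNNReal _ (by positivity)]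
  field_simp
  ring

theorem ae_haarVariance_pos (hε : ∀ i, HasLaw (ε i) (gaussianReal 0 1) P)
    (hind : iIndepFun ε P) (μ : EuclideanSpace ℝ (Fin (2 ^ J))) {σ : ℝ} (hσ : 0 < σ) :
    ∀ᵐ ω ∂P, 0 < haarVariance J (observation μ σ ε ω) := by
  obtain ⟨a, ha⟩ : (haarLevel J).Nonempty := by
    unfold haarLevel
    split_ifs <;> simp
  have hlaw := hasLaw_empInner_haarVec hε hind μ σ (haarLevel_subset_succ J ha)
  have hne : ∀ᵐ ω ∂P, empInner (observation μ σ ε ω) (haarVec J a) ≠ 0 := by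
    have := nullSingletonClass_gaussianReal (μ := empInner μ (haarVec J a))
      (Real.toNNReal_pos.2 (by positivity : 0 < σ ^ 2 / 2 ^ J)).ne'
    refine ae_of_ae_map hlaw.aemeasurable (p := (· ≠ 0)) ?_
    rw [hlaw.map_eq]
    exact Measure.ae_ne _ 0
  filter_upwards [hne] with ω hω
  rw [haarVariance_eq_sum]
  exact mul_pos two_pos (Finset.sum_pos' (fun _ _ => sq_nonneg _) ⟨a, ha, by positivity⟩)

theorem indepFun_haarVariance (hε : ∀ i, HasLaw (ε i) (gaussianReal 0 1) P)
    (hind : iIndepFun ε P) (μ : EuclideanSpace ℝ (Fin (2 ^ J))) (σ : ℝ) {a : ℕ × ℕ}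
    (ha : a ∈ haarIndex J) :
    IndepFun (fun ω => empInner (observation μ σ ε ω) (haarVec J a))
      (fun ω => haarVariance J (observation μ σ ε ω)) P := by
  let i : haarIndex (J + 1) := ⟨a, haarIndex_subset_succ J ha⟩
  let T := (haarLevel J).subtype (· ∈ haarIndex (J + 1))
  have hi : i ∉ T := fun h =>
    Finset.disjoint_left.1 (disjoint_haarLevel_haarIndex J) (Finset.mem_subtype.1 h) ha
  have h := (((empOrthonormal_haarVec J).iIndepFun_observation hε hind μ σ).indepFun_finset₀ {i} T
    (Finset.disjoint_singleton_left.2 hi)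
    fun b => (hasLaw_empInner_haarVec hε hind μ σ b.2).aemeasurable).comp
    (measurable_pi_apply ⟨i, Finset.mem_singleton_self i⟩)
    (by fun_prop : Measurable fun z : T → ℝ => 2 * ∑ b, z b ^ 2)
  refine h.congr .rfl (.of_forall fun ω => ?_)
  simp only [Function.comp_apply, haarVariance_eq_sum]
  rw [Finset.sum_coe_sort T fun b => empInner (observation μ σ ε ω) (haarVec J b) ^ 2,
    Finset.sum_subtype_of_mem (fun b => empInner (observation μ σ ε ω) (haarVec J b) ^ 2)
      fun b hb => haarLevel_subset_succ J hb]

theorem measureReal_haarVariance_le (hJ : 2 ≤ J) (hε : ∀ i, HasLaw (ε i) (gaussianReal 0 1) P)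
    (hind : iIndepFun ε P) (μ : EuclideanSpace ℝ (Fin (2 ^ J))) {σ : ℝ} (hσ : 0 < σ) {β : ℝ}
    (hβ : β ≤ 1 / 2 * phiInv (2 * Real.log ((2 : ℝ) ^ J / 2) / (2 : ℝ) ^ J)) :
    P.real {ω | haarVariance J (observation μ σ ε ω) ≤ 2 * β * σ ^ 2} ≤ 2 / 2 ^ J := by
  have hN : (2 : ℝ) < 2 ^ J := lt_self_pow₀ one_lt_two hJ
  obtain ⟨hx0, hx1⟩ := phiInv_mem_Ioo (two_mul_log_half_div_pos hN)
  have hv : 0 < σ ^ 2 / 2 ^ J := by positivity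
  have htail := measure_sum_sq_le_card_mul_variance (Real.toNNReal_pos.2 hv).ne'
    (fun a : haarLevel J => hasLaw_empInner_haarVec hε hind μ σ (haarLevel_subset_succ J a.2))
    (((empOrthonormal_haarVec J).mono
      (haarLevel_subset_succ J)).iIndepFun_observation hε hind μ σ) Finset.univ hx0 hx1.le
  rw [Finset.card_univ, Fintype.card_coe, cast_card_haarLevel (by omega),
    exp_neg_half_mul_phi_phiInv hN, Real.coe_toNNReal _ hv.le] at htail
  refine (measureReal_mono fun ω hω => ?_).trans htail
  simp only [haarVariance_eq_sum, Set.mem_ofPred_eq] at hω ⊢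
  rw [Finset.sum_coe_sort _ fun a => empInner (observation μ σ ε ω) (haarVec J a) ^ 2]
  calc _ ≤ β * σ ^ 2 := by linarith
    _ ≤ 1 / 2 * phiInv (2 * Real.log (2 ^ J / 2) / 2 ^ J) * σ ^ 2 := by gcongr
    _ = _ := by field_simp

end HaarCoefficients

section HaarRisk

variable {Ω : Type*} [MeasurableSpace Ω] {P : Measure Ω} [IsProbabilityMeasure P] {J : ℕ}
  {ε : Fin (2 ^ J) → Ω → ℝ} {μ : EuclideanSpace ℝ (Fin (2 ^ J))} {σ β W : ℝ}

theorem eight_le_two_pow (hJ : 3 ≤ J) : (8 : ℝ) ≤ 2 ^ J :=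
  calc (8 : ℝ) = 2 ^ 3 := by norm_num
    _ ≤ 2 ^ J := pow_le_pow_right₀ one_le_two hJ

theorem le_half_of_le_half_phiInv (hJ : 2 ≤ J)
    (hβ : β ≤ 1 / 2 * phiInv (2 * Real.log ((2 : ℝ) ^ J / 2) / (2 : ℝ) ^ J)) : β ≤ 1 / 2 := by
  have := (phiInv_mem_Ioo (two_mul_log_half_div_pos (lt_self_pow₀ (one_lt_two (α := ℝ)) hJ))).2
  linarith

theorem integral_haarCoeff_risk_le (hJ : 3 ≤ J) (hε : ∀ i, HasLaw (ε i) (gaussianReal 0 1) P)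
    (hind : iIndepFun ε P) (hσ : 0 < σ) (hβ0 : 0 < β)
    (hβ : β ≤ 1 / 2 * phiInv (2 * Real.log ((2 : ℝ) ^ J / 2) / (2 : ℝ) ^ J))
    (hW : ∑ a ∈ haarLevel J, empInner μ (haarVec J a) ^ 2 ≤ W) {a : ℕ × ℕ}
    (ha : a ∈ haarIndex J) :
    ∫ ω, (empInner μ (haarVec J a) - shrink (Real.exp 1 * 2 ^ J / 2)
        (2 ^ J * β * empInner (observation μ σ ε ω) (haarVec J a) ^ 2 /
          haarVariance J (observation μ σ ε ω)) *
        empInner (observation μ σ ε ω) (haarVec J a)) ^ 2 ∂P ≤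
      35 * min ((σ ^ 2 + 2 * W) * Real.log (2 ^ J) / (2 ^ J * β))
        (empInner μ (haarVec J a) ^ 2) + 8 * Real.log (2 ^ J) * σ ^ 2 / (2 ^ J) ^ 2 := by
  have hN := eight_le_two_pow hJ
  have hlaw := hasLaw_empInner_haarVec hε hind μ σ (haarIndex_subset_succ J ha)
  have hs := integrable_haarVariance hε hind μ σ
  have hW0 : 0 ≤ W := (Finset.sum_nonneg fun _ _ => sq_nonneg _).trans hW
  have hlog := two_le_log hN
  have hthreshold := integral_sq_sub_shrink_mul_le_mul_threshold hN hβ0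
    (le_half_of_le_half_phiInv (by omega) hβ) hlaw hs (ae_haarVariance_pos hε hind μ hσ)
    (by linarith : σ ^ 2 ≤ σ ^ 2 + 2 * W)
    (by rw [integral_haarVariance (by omega) hε hind]; linarith)
  have hsignal := integral_sq_sub_shrink_mul_le_mul_signal hN hσ hβ0 hlaw hs.aemeasurable
    (indepFun_haarVariance hε hind μ σ ha)
    (measureReal_haarVariance_le (by omega) hε hind μ hσ hβ)
  have hD : 0 ≤ (σ ^ 2 + 2 * W) * Real.log (2 ^ J) / (2 ^ J * β) := by positivity
  have hleak : 0 ≤ 8 * Real.log (2 ^ J) * σ ^ 2 / (2 ^ J) ^ 2 := by positivity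
  rw [mul_min_of_nonneg _ _ (by norm_num : (0 : ℝ) ≤ 35), min_add]
  exact le_min (by linarith) hsignal

theorem integrable_haarCoeff_risk (hε : ∀ i, HasLaw (ε i) (gaussianReal 0 1) P)
    (hind : iIndepFun ε P) {a : ℕ × ℕ} (ha : a ∈ haarIndex J) (β : ℝ) :
    Integrable (fun ω => (empInner μ (haarVec J a) - shrink (Real.exp 1 * 2 ^ J / 2)
        (2 ^ J * β * empInner (observation μ σ ε ω) (haarVec J a) ^ 2 /
          haarVariance J (observation μ σ ε ω)) *
        empInner (observation μ σ ε ω) (haarVec J a)) ^ 2) P := by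
  have hlaw := hasLaw_empInner_haarVec hε hind μ σ (haarIndex_subset_succ J ha)
  have hZ := hlaw.aemeasurable
  have hs := (integrable_haarVariance hε hind μ σ).aemeasurable
  exact integrable_sq_sub_shrink_mul hlaw.hasGaussianLaw.memLp_two (by fun_prop) (by positivity) _

theorem integrable_haarLoss (hJ : 1 ≤ J) (hε : ∀ i, HasLaw (ε i) (gaussianReal 0 1) P)
    (hind : iIndepFun ε P) (β : ℝ) :
    Integrable (fun ω => haarLoss J β μ (observation μ σ ε ω)) P := by
  simp_rw [haarLoss_eq_sum hJ]
  exact (integrable_finsetSum _ fun a ha => integrable_haarCoeff_risk hε hind ha β).add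
    (integrable_const _)

theorem integral_haarLoss_le (hJ : 3 ≤ J) (hε : ∀ i, HasLaw (ε i) (gaussianReal 0 1) P)
    (hind : iIndepFun ε P) (hσ : 0 < σ) (hβ0 : 0 < β)
    (hβ : β ≤ 1 / 2 * phiInv (2 * Real.log ((2 : ℝ) ^ J / 2) / (2 : ℝ) ^ J))
    (hW : ∑ a ∈ haarLevel J, empInner μ (haarVec J a) ^ 2 ≤ W) :
    ∫ ω, haarLoss J β μ (observation μ σ ε ω) ∂P ≤
      35 * ∑ a ∈ haarIndex J, min ((σ ^ 2 + 2 * W) * Real.log (2 ^ J) / (2 ^ J * β))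
        (empInner μ (haarVec J a) ^ 2) + 4 * (σ ^ 2 * Real.log (2 ^ J) / 2 ^ J) + W := by
  have hint : ∀ a ∈ haarIndex J, Integrable (fun ω => (empInner μ (haarVec J a) -
      shrink (Real.exp 1 * 2 ^ J / 2)
        (2 ^ J * β * empInner (observation μ σ ε ω) (haarVec J a) ^ 2 /
          haarVariance J (observation μ σ ε ω)) *
        empInner (observation μ σ ε ω) (haarVec J a)) ^ 2) P := fun a ha =>
    integrable_haarCoeff_risk hε hind ha β
  simp_rw [haarLoss_eq_sum (by omega : 1 ≤ J)]
  rw [integral_add (integrable_finsetSum _ hint) (integrable_const _),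
    integral_finsetSum _ hint, integral_const, probReal_univ, one_smul]
  refine add_le_add ((Finset.sum_le_sum fun a ha =>
    integral_haarCoeff_risk_le hJ hε hind hσ hβ0 hβ hW ha).trans_eq ?_) hW
  rw [Finset.sum_add_distrib, ← Finset.mul_sum, Finset.sum_const, nsmul_eq_mul,
    cast_card_haarIndex (by omega)]
  congr 1
  field_simp
  ring

theorem sum_haarIndex (hJ : 1 ≤ J) (F : ℕ × ℕ → ℝ) :
    ∑ a ∈ haarIndex J, F a = F (0, 0) + ∑ j ∈ Finset.Ico 1 J, ∑ a ∈ haarLevel j, F a := by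
  rw [haarIndex, Finset.sum_biUnion fun i _ j _ hij => disjoint_haarLevel hij,
    Finset.range_eq_Ico, Finset.sum_eq_sum_Ico_succ_bot (by omega), haarLevel, if_pos rfl,
    Finset.sum_singleton]

theorem min_sq_le_sqrt_mul_abs {D : ℝ} (hD : 0 ≤ D) (t : ℝ) : min D (t ^ 2) ≤ √D * |t| := by
  rw [← sq_abs]
  rcases le_total (√D) |t| with h | h
  · calc min D (|t| ^ 2) ≤ √D * √D := (min_le_left _ _).trans_eq (Real.mul_self_sqrt hD).symm
      _ ≤ √D * |t| := by gcongr
  · calc min D (|t| ^ 2) ≤ |t| * |t| := (min_le_right _ _).trans_eq (sq _)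
      _ ≤ √D * |t| := by gcongr

theorem sum_min_sq_haarLevel_le {V : NNReal} (hV : eVariationOn (fun i => μ i) Set.univ ≤ V)
    {j : ℕ} (hj0 : j ≠ 0) (hj : j ≤ J) {D : ℝ} (hD : 0 ≤ D) :
    ∑ a ∈ haarLevel j, min D (empInner μ (haarVec J a) ^ 2) ≤
      min (2 ^ j * D) (V * √D * (√2)⁻¹ ^ j) := by
  refine le_min ?_ ?_
  · calc _ ≤ (haarLevel j).card • D := Finset.sum_le_card_nsmul _ _ _ fun _ _ => min_le_left _ _
      _ = 2 ^ j / 2 * D := by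
        rw [nsmul_eq_mul, cast_card_haarLevel (Nat.one_le_iff_ne_zero.2 hj0)]
      _ ≤ 2 ^ j * D := by gcongr; exact half_le_self (by positivity)
  · calc _ ≤ ∑ a ∈ haarLevel j, √D * |empInner μ (haarVec J a)| :=
          Finset.sum_le_sum fun a _ => min_sq_le_sqrt_mul_abs hD _
      _ ≤ √D * (V * (√2)⁻¹ ^ j) := by
        rw [← Finset.mul_sum]
        gcongr
        exact sum_abs_empInner_haarVec_le hj0 hj hV
      _ = V * √D * (√2)⁻¹ ^ j := by ring

theorem sum_min_sq_haarIndex_le (hJ : 1 ≤ J) {V : NNReal}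
    (hV : eVariationOn (fun i => μ i) Set.univ ≤ V) {D : ℝ} (hD : 0 < D) :
    ∑ a ∈ haarIndex J, min D (empInner μ (haarVec J a) ^ 2) ≤
      D + 6 * (V * D) ^ ((2 : ℝ) / 3) := by
  rw [sum_haarIndex hJ]
  refine add_le_add (min_le_left _ _) ?_
  calc _ ≤ ∑ j ∈ Finset.Ico 1 J, min (2 ^ j * D) (V * √D * (√2)⁻¹ ^ j) :=
        Finset.sum_le_sum fun j hj => by
          obtain ⟨hj1, hjJ⟩ := Finset.mem_Ico.1 hj
          exact sum_min_sq_haarLevel_le hV (by omega) hjJ.le hD.le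
    _ ≤ ∑ j ∈ Finset.range J, min (2 ^ j * D) (V * √D * (√2)⁻¹ ^ j) :=
        Finset.sum_le_sum_of_subset_of_nonneg (fun j hj => by simp_all) fun _ _ _ => by positivity
    _ ≤ 6 * (V * D) ^ ((2 : ℝ) / 3) := sum_min_two_pow_mul_le_rpow V.2 hD J

theorem sum_sq_empInner_haarLevel_le (hJ : J ≠ 0) {V : NNReal}
    (hV : eVariationOn (fun i => μ i) Set.univ ≤ V) :
    ∑ a ∈ haarLevel J, empInner μ (haarVec J a) ^ 2 ≤ V ^ 2 / 2 ^ J :=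
  calc ∑ a ∈ haarLevel J, empInner μ (haarVec J a) ^ 2
      = ∑ a ∈ haarLevel J, |empInner μ (haarVec J a)| ^ 2 := by simp only [sq_abs]
    _ ≤ (∑ a ∈ haarLevel J, |empInner μ (haarVec J a)|) ^ 2 :=
        Finset.sum_sq_le_sq_sum_of_nonneg fun _ _ => abs_nonneg _
    _ ≤ (V * (√2)⁻¹ ^ J) ^ 2 := by gcongr; exact sum_abs_empInner_haarVec_le hJ le_rfl hV
    _ = V ^ 2 / 2 ^ J := by
        rw [mul_pow, pow_right_comm, inv_pow, Real.sq_sqrt zero_le_two, inv_pow, div_eq_mul_inv]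

theorem integral_haarLoss_le_rate (hJ : 3 ≤ J) (hε : ∀ i, HasLaw (ε i) (gaussianReal 0 1) P)
    (hind : iIndepFun ε P) (hσ : 0 < σ) (hβ0 : 0 < β)
    (hβ : β ≤ 1 / 2 * phiInv (2 * Real.log ((2 : ℝ) ^ J / 2) / (2 : ℝ) ^ J)) {V : NNReal}
    (hV : eVariationOn (fun i => μ i) Set.univ ≤ V) :
    ∫ ω, haarLoss J β μ (observation μ σ ε ω) ∂P ≤
      1160 / β * max ((V * σ ^ 2 * Real.log (2 ^ J) / 2 ^ J) ^ ((2 : ℝ) / 3))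
        (max ((V : ℝ) ^ 2 / 2 ^ J) (σ ^ 2 * Real.log (2 ^ J) / 2 ^ J)) := by
  have hN := eight_le_two_pow hJ
  have hlog := two_le_log hN
  have hβ1 : β ≤ 1 := by linarith [le_half_of_le_half_phiInv (by omega) hβ]
  calc _ ≤ _ := integral_haarLoss_le hJ hε hind hσ hβ0 hβ
        (sum_sq_empInner_haarLevel_le (by omega) hV)
    _ ≤ _ := by
        gcongr
        exact sum_min_sq_haarIndex_le (by omega) hV (by positivity)
    _ ≤ _ := oracle_bound_le_rate V.coe_nonneg (by linarith) hβ0 hβ1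

end HaarRisk

end HaarMix

end

theorem corollary1 :
    ∃ C : ℝ, 0 < C ∧
      ∀ (J : ℕ), 3 ≤ J →
      ∀ (β : ℝ), 0 < β →
        β ≤ 1 / 2 * HaarMix.phiInv (2 * Real.log ((2 : ℝ) ^ J / 2) / (2 : ℝ) ^ J) →
        (∀ y : EuclideanSpace ℝ (Fin (2 ^ J)),
          HaarMix.haarEstimator J β y = HaarMix.haarShrinkage J β y) ∧
        ∀ (x : Fin (2 ^ J + 1) → ℝ), StrictMono x → x 0 = 0 → x (Fin.last (2 ^ J)) = 1 →
        ∀ (σ : ℝ), 0 < σ →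
        ∀ (Ω : Type*) [MeasurableSpace Ω] (P : Measure Ω) [IsProbabilityMeasure P]
          (ε : Fin (2 ^ J) → Ω → ℝ),
          (∀ i, HasLaw (ε i) (gaussianReal 0 1) P) → iIndepFun ε P →
        ∀ (f : ℝ → ℝ), BoundedVariationOn f (Set.Icc 0 1) →
          Integrable (fun ω => HaarMix.haarLoss J β (HaarMix.signal f x)
            (HaarMix.observation (HaarMix.signal f x) σ ε ω)) P ∧
          ∫ ω, HaarMix.haarLoss J β (HaarMix.signal f x)
              (HaarMix.observation (HaarMix.signal f x) σ ε ω) ∂P ≤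
            C / β *
              max ((HaarMix.totalVariation f * σ ^ 2 * Real.log ((2 : ℝ) ^ J) / (2 : ℝ) ^ J) ^
                  ((2 : ℝ) / 3))
                (max (HaarMix.totalVariation f ^ 2 / (2 : ℝ) ^ J)
                  (σ ^ 2 * Real.log ((2 : ℝ) ^ J) / (2 : ℝ) ^ J)) := by
  refine ⟨1160, by norm_num, fun J hJ β hβ0 hβ =>
    ⟨HaarMix.haarEstimator_eq_haarShrinkage (by omega) β, ?_⟩⟩
  intro x hx hx0 hx1 σ hσ Ω _ P _ ε hε hind f hf
  refine ⟨HaarMix.integrable_haarLoss (by omega) hε hind β, ?_⟩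
  have hrate := HaarMix.integral_haarLoss_le_rate hJ hε hind hσ hβ0 hβ
    (HaarMix.eVariationOn_signal_le hf hx.monotone hx0 hx1)
  rwa [Real.coe_toNNReal (HaarMix.totalVariation f) ENNReal.toReal_nonneg] at hrate
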